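/- For positive integers $\ell, t$ and $n \ge 0$, let $\mathrm{RD}^{(\ell,t)}(n)$ denote the number of partitions of $n$ in which no part is divisible by $\ell$ and every part occurs fewer than $t$ times. Then, for all $n \ge 0$, $$\mathrm{RD}^{(4,9)}(24n+23) \equiv 0 \pmod{24},$$ $$\mathrm{RD}^{(4,9)}(48n+29) \equiv 0 \pmod{24},$$ $$\mathrm{RD}^{(4,9)}(96n+89) \equiv 0 \pmod{24}.$$ -/

import Mathlib

/-- The set of partitions of `n` that are simultaneously `ℓ`-regular (no part is divisible by `ℓ`)
and `t`-distinct (every part occurs fewer than `t` times). -/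
def regularDistinct (ℓ t n : ℕ) : Finset n.Partition :=
  {p : n.Partition | (∀ i ∈ p.parts, ¬ ℓ ∣ i) ∧ ∀ i ∈ p.parts, p.parts.count i < t}

/-- The number `RD^{(ℓ,t)}(n)` of partitions of `n` that are simultaneously `ℓ`-regular and
`t`-distinct. -/
def RD (ℓ t n : ℕ) : ℕ := (regularDistinct ℓ t n).card

/-! Write q for `X` and E_k for `euler k`. The generating function of RD^{(4,9)} is E_4 E_9 / (E_1
E_36). Theta identities show that its odd-indexed coefficients are those of f = E_2^3 E_3 / (E_1^3
E_6), so everything reduces to f modulo 3 and modulo 8 (`genFun_regularDistinct`,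
`coeff_genFun_odd`).

Modulo 3, cubing is the substitution q → q^3, so f ≡ 1 and every coefficient but the constant one is
divisible by 3 (`quotient_sub_one_dvd_three`).

Modulo 8, the key is the self-similar 2-dissection f(q) = f(q^2)^2 + q o(q^2), with o an explicit
theta quotient (`quotient_dissect`). Three facts feed it: f is even at exponents 3n+2, because f ≡
ψ(q) E_3/E_6 modulo 2 and triangular numbers avoid 2 modulo 3; o vanishes modulo 8 at exponents
6n+5; and o is a series in q^6 modulo 4. The first progression is read off o directly. For the other
two, the dissection is squared once or twice: each squaring puts a factor 2 on the odd part, and the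
remaining powers of 2 come from the three facts (`vanishesMod_of_dissect`).

The theta identities all descend from Jacobi's triple product, obtained as the limit of a finite
form of the q-binomial theorem, together with splittings of theta sums by residue classes of the
summation index. -/

open PowerSeries PowerSeries.WithPiTopology Filter Topology

/-! ### Euler-type products and the substitutions q → q^m and q → -q -/

/-- The infinite product `∏ (1 + c X ^ (a n + b))` over `n ≥ 0`. -/
noncomputable def qProd (c : ℤ) (a b : ℕ) : ℤ⟦X⟧ := ∏' n : ℕ, (1 + C c * X ^ (a * n + b))

/-- Euler's product `∏ (1 - X ^ (k n))` over `n ≥ 1`. -/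
noncomputable def euler (k : ℕ) : ℤ⟦X⟧ := qProd (-1) k k

theorem multipliable_qProd (c : ℤ) {a : ℕ} (ha : 0 < a) (b : ℕ) :
    Multipliable fun n : ℕ ↦ (1 + C c * X ^ (a * n + b) : ℤ⟦X⟧) := by
  apply multipliable_one_add_of_tendsto_order_atTop_nhds_top
  refine ENat.tendsto_nhds_top_iff_natCast_lt.mpr (fun n ↦ eventually_atTop.mpr ⟨n + 1, ?_⟩)
  intro m hm
  refine lt_of_lt_of_le ?_ (le_order_mul _ _)
  rw [order_X_pow]
  refine lt_of_lt_of_le ?_ le_add_self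
  norm_cast
  nlinarith

theorem hasProd_qProd (c : ℤ) {a : ℕ} (ha : 0 < a) (b : ℕ) :
    HasProd (fun n : ℕ ↦ (1 + C c * X ^ (a * n + b) : ℤ⟦X⟧)) (qProd c a b) :=
  (multipliable_qProd c ha b).hasProd

theorem qProd_dissect (c : ℤ) {a : ℕ} (ha : 0 < a) (b m : ℕ) (hm : 0 < m) :
    qProd c a b = ∏ r : Fin m, qProd c (a * m) (a * r + b) := by
  have : NeZero m := ⟨hm.ne'⟩
  have h := hasProd_qProd c ha b
  rw [← ((Equiv.prodComm _ _).trans (Nat.divModEquiv m).symm).hasProd_iff] at h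
  have h2 := h.prod_fiberwise (g := fun r : Fin m ↦ qProd c (a * m) (a * r + b)) fun r ↦ by
    convert hasProd_qProd c (Nat.mul_pos ha hm) (a * r + b) using 1
    funext n
    simp only [Function.comp, Equiv.trans_apply, Equiv.prodComm_apply, Prod.swap_prod_mk,
      Nat.divModEquiv_symm_apply]
    congr 3
    ring
  exact h2.unique (hasProd_fintype _)

theorem qProd_mul_neg (c : ℤ) {a : ℕ} (ha : 0 < a) (b : ℕ) :
    qProd c a b * qProd (-c) a b = qProd (-c ^ 2) (2 * a) (2 * b) := by
  rw [qProd, qProd, ← (multipliable_qProd c ha b).tprod_mul (multipliable_qProd (-c) ha b), qProd]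
  refine tprod_congr fun n ↦ ?_
  have : (2 * a * n + 2 * b) = (a * n + b) * 2 := by ring
  rw [this, pow_mul]
  simp only [map_neg, map_pow]
  ring

theorem euler_split_two {k : ℕ} (hk : 0 < k) :
    euler k = qProd (-1) (2 * k) k * euler (2 * k) := by
  rw [euler, qProd_dissect _ hk _ 2 two_pos, Fin.prod_univ_two, euler, mul_comm k 2]
  congr 2 <;> simp; ring

theorem qProd_one_mul_euler {a : ℕ} (ha : 0 < a) :
    qProd 1 a a * euler a = euler (2 * a) := by
  rw [euler, qProd_mul_neg 1 ha, euler]; norm_num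

theorem continuous_expand (m : ℕ) (hm : m ≠ 0) :
    Continuous (expand m hm : ℤ⟦X⟧ → ℤ⟦X⟧) := by
  rw [continuous_iff_continuousAt]
  intro f
  rw [ContinuousAt, tendsto_iff_coeff_tendsto]
  intro d
  simp only [coeff_expand]
  split_ifs
  · exact (continuous_coeff ℤ _).tendsto f
  · exact tendsto_const_nhds

theorem continuous_evalNegHom : Continuous (evalNegHom : ℤ⟦X⟧ → ℤ⟦X⟧) := by
  rw [continuous_iff_continuousAt]
  intro f
  rw [ContinuousAt, tendsto_iff_coeff_tendsto]
  intro d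
  simp only [evalNegHom, coeff_rescale]
  exact ((continuous_coeff ℤ d).tendsto f).const_mul _

theorem expand_qProd (c : ℤ) {a : ℕ} (ha : 0 < a) (b m : ℕ) (hm : m ≠ 0) :
    expand m hm (qProd c a b) = qProd c (m * a) (m * b) := by
  rw [qProd, (multipliable_qProd c ha b).map_tprod _ (continuous_expand m hm), qProd]
  refine tprod_congr fun n ↦ ?_
  rw [map_add, map_mul, map_one, expand_C, map_pow, expand_X, ← pow_mul]
  congr 3
  ring

theorem expand_euler {k : ℕ} (hk : 0 < k) (m : ℕ) (hm : m ≠ 0) :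
    expand m hm (euler k) = euler (m * k) := expand_qProd _ hk _ _ _

theorem evalNegHom_C (c : ℤ) : evalNegHom (C c : ℤ⟦X⟧) = C c := by
  ext n
  rw [evalNegHom, coeff_rescale, coeff_C]
  split_ifs with h <;> simp [h]

theorem evalNegHom_qProd_even (c : ℤ) {a b : ℕ} (ha : 0 < a) (ha2 : Even a) (hb : Even b) :
    evalNegHom (qProd c a b) = qProd c a b := by
  rw [qProd, (multipliable_qProd c ha b).map_tprod _ continuous_evalNegHom]
  refine tprod_congr fun n ↦ ?_
  rw [map_add, map_mul, map_one, evalNegHom_C, map_pow, evalNegHom_X,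
    ((ha2.mul_right n).add hb).neg_pow]

theorem evalNegHom_qProd_odd (c : ℤ) {a b : ℕ} (ha : 0 < a) (ha2 : Even a) (hb : Odd b) :
    evalNegHom (qProd c a b) = qProd (-c) a b := by
  rw [qProd, (multipliable_qProd c ha b).map_tprod _ continuous_evalNegHom]
  refine tprod_congr fun n ↦ ?_
  rw [map_add, map_mul, map_one, evalNegHom_C, map_pow, evalNegHom_X,
    ((ha2.mul_right n).add_odd hb).neg_pow, map_neg, mul_neg, neg_mul]

theorem evalNegHom_euler_even {k : ℕ} (hk : 0 < k) (h : Even k) :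
    evalNegHom (euler k) = euler k := evalNegHom_qProd_even _ hk h h

theorem evalNegHom_euler_odd {k : ℕ} (hk : Odd k) :
    evalNegHom (euler k) = qProd 1 (2 * k) k * euler (2 * k) := by
  rw [euler_split_two hk.pos, map_mul, evalNegHom_qProd_odd _ (by have := hk.pos; lia) (by simp) hk,
    evalNegHom_euler_even (by have := hk.pos; lia) (by simp), neg_neg]

theorem constantCoeff_qProd (c : ℤ) {a b : ℕ} (ha : 0 < a) (hb : 0 < b) :
    constantCoeff (qProd c a b) = 1 := by
  rw [qProd, (multipliable_qProd c ha b).map_tprod _ (continuous_constantCoeff ℤ)]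
  simp [hb.ne']

theorem qProd_ne_zero (c : ℤ) {a b : ℕ} (ha : 0 < a) (hb : 0 < b) : qProd c a b ≠ 0 := by
  intro h
  simpa [h] using constantCoeff_qProd c ha hb

theorem euler_ne_zero {k : ℕ} (hk : 0 < k) : euler k ≠ 0 := qProd_ne_zero _ hk hk

theorem exists_mul_euler_eq_one {k : ℕ} (hk : 0 < k) : ∃ I : ℤ⟦X⟧, euler k * I = 1 :=
  ⟨invOfUnit (euler k) 1, mul_invOfUnit _ _ (constantCoeff_qProd _ hk hk)⟩

/-- Every finite partial product is 1 modulo `X ^ d`, and coefficients are continuous, so the limit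
inherits the congruence. -/
theorem X_pow_dvd_qProd_sub_one (c : ℤ) {a b : ℕ} (ha : 0 < a) {d : ℕ} (hd : d ≤ b) :
    X ^ d ∣ qProd c a b - 1 := by
  have key : ∀ s : Finset ℕ, X ^ d ∣ ∏ n ∈ s, (1 + C c * X ^ (a * n + b) : ℤ⟦X⟧) - 1 := by
    intro s
    induction s using Finset.induction_on with
    | empty => simp
    | insert n s hn ih =>
      rw [Finset.prod_insert hn]
      obtain ⟨g, hg⟩ := ih
      have h1 : (X : ℤ⟦X⟧) ^ d ∣ X ^ (a * n + b) := pow_dvd_pow _ (by lia)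
      obtain ⟨u, hu⟩ := h1
      rw [hu, sub_eq_iff_eq_add.mp hg]
      exact ⟨g + C c * u * (X ^ d * g + 1), by ring⟩
  rw [X_pow_dvd_iff]
  intro m hm
  have h := ((continuous_coeff ℤ m).tendsto _).comp (hasProd_qProd c ha b)
  have h2 : coeff m (qProd c a b) = coeff m (1 : ℤ⟦X⟧) := by
    refine tendsto_nhds_unique h (tendsto_const_nhds.congr fun s ↦ ?_)
    have := X_pow_dvd_iff.mp (key s) m hm
    rw [map_sub, sub_eq_zero] at this
    exact this.symm
  rw [map_sub, h2, sub_self]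

theorem qProd_eq_prod_range_mul (c : ℤ) {a : ℕ} (ha : 0 < a) (b N : ℕ) :
    qProd c a b = (∏ n ∈ Finset.range N, (1 + C c * X ^ (a * n + b))) * qProd c a (a * N + b) := by
  have h : Multipliable fun n : ℕ ↦ (1 + C c * X ^ (a * (n + N) + b) : ℤ⟦X⟧) := by
    convert multipliable_qProd c ha (a * N + b) using 4
    ring
  have key := Multipliable.prod_mul_tprod_nat_mul'
    (f := fun n : ℕ ↦ (1 + C c * X ^ (a * n + b) : ℤ⟦X⟧)) (k := N) h
  have h2 : qProd c a (a * N + b) = ∏' n : ℕ, (1 + C c * X ^ (a * (n + N) + b) : ℤ⟦X⟧) := by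
    refine tprod_congr fun n ↦ ?_
    rw [mul_add, add_assoc]
  rw [h2]
  exact key.symm

/-! ### The q-binomial theorem -/

section QBinomial
variable {R : Type*} [CommRing R]

/-- The Gaussian binomial coefficient `[m + k, k]` at `q`. -/
def gaussBinom (q : R) : ℕ → ℕ → R
  | 0, _ => 1
  | _ + 1, 0 => 1
  | m + 1, k + 1 => q ^ (k + 1) * gaussBinom q m (k + 1) + gaussBinom q (m + 1) k

theorem gaussBinom_zero_right (q : R) (m : ℕ) : gaussBinom q m 0 = 1 := by
  cases m <;> simp [gaussBinom]

/-- The q-factorial formula cleared of denominators, so that it makes sense in any commutative ring;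
the q-Pascal rule gives it by double induction. -/
theorem gaussBinom_mul (q : R) (m k : ℕ) :
    gaussBinom q m k * (∏ i ∈ Finset.range m, (1 - q ^ (i + 1))) *
      (∏ i ∈ Finset.range k, (1 - q ^ (i + 1))) = ∏ i ∈ Finset.range (m + k), (1 - q ^ (i + 1)) := by
  induction m generalizing k with
  | zero => simp [gaussBinom]
  | succ m ihm =>
    induction k with
    | zero => simp [gaussBinom]
    | succ k ihk =>
      have h1 := ihm (k + 1)
      rw [show m + 1 + (k + 1) = (m + 1 + k) + 1 by ring, Finset.prod_range_succ _ (m + 1 + k)]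
      rw [show m + (k + 1) = m + 1 + k by ring] at h1
      rw [gaussBinom]
      rw [Finset.prod_range_succ _ m] at ihk ⊢
      rw [Finset.prod_range_succ _ k] at h1 ⊢
      linear_combination (q ^ (k + 1) * (1 - q ^ (m + 1))) * h1 + (1 - q ^ (k + 1)) * ihk

theorem prod_add_mul_pow (q u v : R) (n : ℕ) :
    ∏ i ∈ Finset.range n, (u + v * q ^ i) = ∑ p ∈ Finset.HasAntidiagonal.antidiagonal n,
      q ^ (p.2.choose 2) * gaussBinom q p.1 p.2 * v ^ p.2 * u ^ p.1 := by
  induction n generalizing v with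
  | zero => simp [gaussBinom]
  | succ n ih =>
    have h1 : ∀ i, u + v * q ^ (i + 1) = u + (v * q) * q ^ i := fun i ↦ by ring
    rw [Finset.prod_range_succ']
    simp only [h1, ih, pow_zero, mul_one]
    -- Splitting off the factor i = 0, which is u + v, leaves the product for v * q. `A` and `B`
    -- collect the contributions of u and of v; the q-Pascal rule says that they add up to the
    -- claimed summand.
    set F : ℕ → ℕ → R := fun m k ↦
      q ^ (k.choose 2) * gaussBinom q m k * (v * q) ^ k * u ^ m with hF
    let A : ℕ × ℕ → R := fun p ↦ match p with
      | (0, _) => 0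
      | (m + 1, k) => F m k * u
    let B : ℕ × ℕ → R := fun p ↦ match p with
      | (_, 0) => 0
      | (m, k + 1) => F m k * v
    have hch : ∀ k : ℕ, (k + 1).choose 2 = k.choose 2 + k := fun k ↦ by
      rw [Nat.choose_succ_succ' k 1, Nat.choose_one_right, add_comm]
    have h2 : ∑ p ∈ Finset.HasAntidiagonal.antidiagonal (n + 1),
        q ^ (p.2.choose 2) * gaussBinom q p.1 p.2 * v ^ p.2 * u ^ p.1 =
        ∑ p ∈ Finset.HasAntidiagonal.antidiagonal (n + 1), (A p + B p) := by
      refine Finset.sum_congr rfl fun p hp ↦ ?_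
      obtain ⟨m, k⟩ := p
      rw [Finset.HasAntidiagonal.mem_antidiagonal] at hp
      match m, k with
      | 0, 0 => simp at hp
      | 0, k + 1 => simp only [A, B, hF, hch, gaussBinom]; ring
      | m + 1, 0 => simp only [A, B, hF, gaussBinom_zero_right]; simp; ring
      | m + 1, k + 1 => simp only [A, B, hF, hch, gaussBinom]; ring
    rw [h2, Finset.sum_add_distrib, Finset.Nat.sum_antidiagonal_succ,
      Finset.Nat.sum_antidiagonal_succ', mul_add, Finset.sum_mul, Finset.sum_mul]
    simp [A, B, hF]

end QBinomial

/-! ### Jacobi's triple product -/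

/-- The triangular number `n (n + 1) / 2` of an integer. -/
def triangular (n : ℤ) : ℕ := (n * (n + 1) / 2).toNat

theorem two_mul_triangular (n : ℤ) : 2 * (triangular n : ℤ) = n * (n + 1) := by
  have h2 : 2 ∣ n * (n + 1) := even_iff_two_dvd.mp (Int.even_mul_succ_self n)
  have h0 : 0 ≤ n * (n + 1) := by
    rcases le_or_gt 0 n with h | h
    · positivity
    · nlinarith
  rw [triangular, Int.toNat_of_nonneg (by positivity), Int.mul_ediv_cancel' h2]

theorem triangular_add_triangular_neg (n : ℤ) :
    triangular n + triangular (-n) = n.natAbs * n.natAbs := by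
  zify
  have h1 := two_mul_triangular n
  have h2 := two_mul_triangular (-n)
  have h3 := abs_mul_abs_self n
  linarith

theorem prod_range_succ_pow (q : ℤ⟦X⟧) (N : ℕ) :
    ∏ i ∈ Finset.range (N + 1), q ^ i = q ^ triangular N := by
  rw [Finset.prod_pow_eq_pow_sum]
  congr 1
  zify
  have h := Finset.sum_range_id_mul_two (N + 1)
  have h2 := two_mul_triangular N
  zify at h
  simp at h
  linarith

/-- This is the q-binomial theorem with 2N + 1 factors u + v q^i at u = x q^N, v = 1, where q = x y.
The first N + 1 factors are q^i (1 + x q^(N-i)), the others x q^N (1 + y q^i). -/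
theorem finite_triple_product {x y : ℤ⟦X⟧} (hx : x ≠ 0) (hy : y ≠ 0) (N : ℕ) :
    (∏ n ∈ Finset.range (N + 1), (1 + x * (x * y) ^ n)) *
      (∏ n ∈ Finset.range N, (1 + y * (x * y) ^ n)) =
    ∑ p ∈ Finset.HasAntidiagonal.antidiagonal (2 * N + 1), gaussBinom (x * y) p.1 p.2 *
      (x ^ triangular (p.1 - N) * y ^ triangular (N - p.1)) := by
  set q := x * y with hq
  have hq0 : q ≠ 0 := mul_ne_zero hx hy
  -- The monomials extracted from the two groups of factors; multiplying by them avoids negative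
  -- powers.
  have hc : q ^ triangular N * (x * q ^ N) ^ N ≠ 0 := by positivity
  apply mul_left_cancel₀ hc
  have h1 := prod_add_mul_pow q (x * q ^ N) 1 (2 * N + 1)
  rw [show 2 * N + 1 = (N + 1) + N by ring, Finset.prod_range_add] at h1
  have h2 : ∏ i ∈ Finset.range (N + 1), (x * q ^ N + 1 * q ^ i) =
      q ^ triangular N * ∏ n ∈ Finset.range (N + 1), (1 + x * q ^ n) := by
    rw [← prod_range_succ_pow, ← Finset.prod_range_reflect (fun i ↦ 1 + x * q ^ i),
      ← Finset.prod_mul_distrib]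
    refine Finset.prod_congr rfl fun i hi ↦ ?_
    have hi' : i ≤ N := by simpa [Nat.lt_succ_iff] using hi
    obtain ⟨j, rfl⟩ := Nat.exists_eq_add_of_le hi'
    rw [show i + j + 1 - 1 - i = j by lia]
    ring
  have h3 : ∏ i ∈ Finset.range N, (x * q ^ N + 1 * q ^ (N + 1 + i)) =
      (x * q ^ N) ^ N * ∏ n ∈ Finset.range N, (1 + y * q ^ n) := by
    have h4 : (x * q ^ N) ^ N = ∏ _i ∈ Finset.range N, (x * q ^ N) := by simp
    rw [h4, ← Finset.prod_mul_distrib]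
    refine Finset.prod_congr rfl fun i hi ↦ ?_
    rw [hq]
    ring
  rw [h2, h3] at h1
  rw [show 2 * N + 1 = (N + 1) + N by ring]
  calc _ = _ := by ring
    _ = _ := h1
    _ = _ := by
      rw [Finset.mul_sum]
      refine Finset.sum_congr rfl fun p hp ↦ ?_
      obtain ⟨m, k⟩ := p
      rw [Finset.HasAntidiagonal.mem_antidiagonal] at hp
      simp only at hp ⊢
      have hch : 2 * (k.choose 2 : ℤ) = k * (k - 1) := by
        have := two_mul_triangular (k - 1)
        rw [Nat.choose_two_right]
        have h5 := Nat.div_mul_cancel (even_iff_two_dvd.mp (Nat.even_mul_pred_self k))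
        rcases k with _ | k
        · simp
        · zify at h5
          simp only [Nat.add_sub_cancel] at h5 ⊢
          push_cast at h5 ⊢
          linarith
      have ex : triangular N + N * N + N + triangular (m - N) = k.choose 2 + N * m + m := by
        zify
        have a1 := two_mul_triangular N
        have a2 := two_mul_triangular (m - N)
        have a3 : (k : ℤ) = 2 * N + 1 - m := by lia
        rw [a3] at hch
        linarith
      have ey : triangular N + N * N + triangular (N - m) = k.choose 2 + N * m := by
        zify
        have a1 := two_mul_triangular N
        have a2 := two_mul_triangular (N - m)
        have a3 : (k : ℤ) = 2 * N + 1 - m := by lia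
        rw [a3] at hch
        linarith
      have hx' : x ^ (triangular N + N * N + N + triangular (m - N)) =
        x ^ (k.choose 2 + N * m + m) := by rw [ex]
      have hy' : y ^ (triangular N + N * N + triangular (N - m)) = y ^ (k.choose 2 + N * m) := by
        rw [ey]
      symm
      calc _ = gaussBinom q m k * x ^ (triangular N + N * N + N + triangular (m - N)) *
            y ^ (triangular N + N * N + triangular (N - m)) := by rw [hq]; ring
        _ = _ := by rw [hx', hy', hq]; ring

/-- Ramanujan's theta function `∑ (c X ^ a) ^ (n (n + 1) / 2) (c X ^ b) ^ (n (n - 1) / 2)`,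
summed over `n ∈ ℤ`, for a sign `c`. -/
noncomputable def theta (c : ℤ) (a b : ℕ) : ℤ⟦X⟧ :=
  ∑' n : ℤ, C (c ^ n.natAbs) * X ^ (a * triangular n + b * triangular (-n))

theorem summable_C_mul_X_pow {ι : Type*} (c : ι → ℤ) (e : ι → ℕ)
    (he : ∀ d, {i | e i = d}.Finite) : Summable fun i ↦ (C (c i) * X ^ e i : ℤ⟦X⟧) := by
  rw [summable_iff_summable_coeff]
  intro d
  refine summable_of_hasFiniteSupport ((he d).subset fun i hi ↦ ?_)
  rw [Function.mem_support, coeff_C_mul, coeff_X_pow] at hi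
  by_contra h
  simp [Ne.symm h] at hi

theorem natAbs_le_theta_exponent {a b : ℕ} (ha : 0 < a) (hb : 0 < b) (n : ℤ) :
    n.natAbs ≤ a * triangular n + b * triangular (-n) := by
  have := triangular_add_triangular_neg n
  nlinarith [Nat.le_mul_self n.natAbs, Nat.zero_le (triangular n), Nat.zero_le (triangular (-n))]

theorem finite_natAbs_le (d : ℕ) : {n : ℤ | n.natAbs ≤ d}.Finite :=
  (Set.finite_Icc (-d : ℤ) d).subset fun n hn ↦ by
    simp only [Set.mem_ofPred_eq, Set.mem_Icc] at hn ⊢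
    lia

theorem summable_theta (c : ℤ) {a b : ℕ} (ha : 0 < a) (hb : 0 < b) :
    Summable fun n : ℤ ↦
      (C (c ^ n.natAbs) * X ^ (a * triangular n + b * triangular (-n)) : ℤ⟦X⟧) :=
  summable_C_mul_X_pow _ _ fun d ↦ (finite_natAbs_le d).subset fun n hn ↦
    (natAbs_le_theta_exponent ha hb n).trans hn.le

theorem euler_eq_prod_range_mul {k : ℕ} (hk : 0 < k) (N : ℕ) :
    euler k = (∏ n ∈ Finset.range N, (1 - (X ^ k) ^ (n + 1))) * qProd (-1) k (k * N + k) := by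
  rw [euler, qProd_eq_prod_range_mul _ hk _ N]
  congr 1
  refine Finset.prod_congr rfl fun n _ ↦ ?_
  rw [← pow_mul, mul_add, mul_one]
  simp [sub_eq_add_neg]

/-- The q-factorial formula turns the product into a quotient of three tails of Euler's product,
each of them 1 modulo `X ^ d`. This is the limit that takes the finite triple product to the
infinite one. -/
theorem X_pow_dvd_euler_mul_gaussBinom_sub_one {k : ℕ} (hk : 0 < k) {m j d : ℕ} (hm : d ≤ m)
    (hj : d ≤ j) : X ^ d ∣ euler k * gaussBinom (X ^ k) m j - 1 := by
  have h := gaussBinom_mul (X ^ k : ℤ⟦X⟧) m j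
  have hne : ∏ i ∈ Finset.range j, (1 - (X ^ k : ℤ⟦X⟧) ^ (i + 1)) ≠ 0 := by
    intro h0
    apply euler_ne_zero hk
    rw [euler_eq_prod_range_mul hk j, h0, zero_mul]
  have h1 := euler_eq_prod_range_mul hk (m + j)
  have h2 := euler_eq_prod_range_mul hk m
  have h3 := euler_eq_prod_range_mul hk j
  have h4 : euler k * gaussBinom (X ^ k) m j * qProd (-1) k (k * (m + j) + k) =
      qProd (-1) k (k * j + k) * qProd (-1) k (k * m + k) := by
    have hm0 : ∏ i ∈ Finset.range m, (1 - (X ^ k : ℤ⟦X⟧) ^ (i + 1)) ≠ 0 := by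
      intro h0
      apply euler_ne_zero hk
      rw [h2, h0, zero_mul]
    apply mul_left_cancel₀ (mul_ne_zero hm0 hne)
    rw [← h] at h1
    calc _ = euler k * (gaussBinom (X ^ k) m j *
              (∏ i ∈ Finset.range m, (1 - (X ^ k : ℤ⟦X⟧) ^ (i + 1))) *
              (∏ i ∈ Finset.range j, (1 - (X ^ k : ℤ⟦X⟧) ^ (i + 1))) *
              qProd (-1) k (k * (m + j) + k)) := by ring
      _ = euler k * euler k := by rw [← h1]
      _ = ((∏ n ∈ Finset.range m, (1 - (X ^ k) ^ (n + 1))) * qProd (-1) k (k * m + k)) *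
          ((∏ n ∈ Finset.range j, (1 - (X ^ k) ^ (n + 1))) * qProd (-1) k (k * j + k)) := by
        rw [← h2, ← h3]
      _ = _ := by ring
  have hm' : d ≤ k * m + k := by nlinarith
  have hj' : d ≤ k * j + k := by nlinarith
  have hmj : d ≤ k * (m + j) + k := by nlinarith
  obtain ⟨u, hu⟩ := X_pow_dvd_qProd_sub_one (-1) hk hm'
  obtain ⟨v, hv⟩ := X_pow_dvd_qProd_sub_one (-1) hk hj'
  obtain ⟨w, hw⟩ := X_pow_dvd_qProd_sub_one (-1) hk hmj
  rw [sub_eq_iff_eq_add] at hu hv hw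
  rw [hu, hv, hw] at h4
  exact ⟨u + v + X ^ d * u * v - euler k * gaussBinom (X ^ k) m j * w, by linear_combination h4⟩

/-- **Jacobi's triple product identity**. -/
theorem triple_product {c : ℤ} (hc : c * c = 1) {a b : ℕ} (ha : 0 < a) (hb : 0 < b) :
    euler (a + b) * qProd c (a + b) a * qProd c (a + b) b = theta c a b := by
  have hab : 0 < a + b := by lia
  set x : ℤ⟦X⟧ := C c * X ^ a with hx
  set y : ℤ⟦X⟧ := C c * X ^ b with hy
  have hc0 : (C c : ℤ⟦X⟧) ≠ 0 := by
    rw [Ne, map_eq_zero_iff _ (C_injective)]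
    rintro rfl
    simp at hc
  have hcC : (C c : ℤ⟦X⟧) * C c = 1 := by rw [← map_mul, hc, map_one]
  have hx0 : x ≠ 0 := mul_ne_zero hc0 (pow_ne_zero _ X_ne_zero)
  have hy0 : y ≠ 0 := mul_ne_zero hc0 (pow_ne_zero _ X_ne_zero)
  have hxy : x * y = X ^ (a + b) := by
    rw [hx, hy, pow_add]
    linear_combination (X ^ a * X ^ b) * hcC
  set t : ℤ → ℤ⟦X⟧ := fun n ↦
    C (c ^ n.natAbs) * X ^ (a * triangular n + b * triangular (-n)) with ht
  have hterm : ∀ n : ℤ, x ^ triangular n * y ^ triangular (-n) = t n := by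
    intro n
    rw [hx, hy, ht]
    -- The sign appears to the power n^2, which has the parity of |n|, and c squares to 1.
    have h1 : (C c : ℤ⟦X⟧) ^ (triangular n + triangular (-n)) = C (c ^ n.natAbs) := by
      rw [triangular_add_triangular_neg, map_pow]
      rcases Nat.even_or_odd' n.natAbs with ⟨r, h | h⟩
      · rw [h, mul_assoc, pow_mul _ 2, pow_two, hcC, one_pow, pow_mul, pow_two, hcC, one_pow]
      · rw [h, pow_mul]
        have : (C c : ℤ⟦X⟧) ^ (2 * r + 1) = C c := by
          rw [pow_succ, pow_mul, pow_two, hcC, one_pow, one_mul]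
        rw [this, this]
    simp only [← h1]
    ring
  have hlim := (((hasProd_qProd c hab a).tendsto_prod_nat.comp (tendsto_add_atTop_nat 1)).mul
    (hasProd_qProd c hab b).tendsto_prod_nat).const_mul (euler (a + b))
  rw [mul_assoc]
  refine tendsto_nhds_unique hlim ?_
  rw [tendsto_iff_coeff_tendsto]
  intro d
  -- Terms with |n| > d do not reach the coefficient of q^d. For |n| ≤ d this bound on N makes both
  -- lower indices of the Gaussian binomial at least d + 1, so it can be replaced by its limit.
  refine tendsto_atTop_of_eventually_const (i₀ := 2 * d + 2) fun N hN ↦ ?_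
  have hfin := finite_triple_product hx0 hy0 N
  rw [hxy] at hfin
  have e1 : ∏ n ∈ Finset.range (N + 1), (1 + C c * X ^ ((a + b) * n + a) : ℤ⟦X⟧) =
      ∏ n ∈ Finset.range (N + 1), (1 + x * (X ^ (a + b)) ^ n) :=
    Finset.prod_congr rfl fun n _ ↦ by rw [hx]; ring
  have e2 : ∏ n ∈ Finset.range N, (1 + C c * X ^ ((a + b) * n + b) : ℤ⟦X⟧) =
      ∏ n ∈ Finset.range N, (1 + y * (X ^ (a + b)) ^ n) :=
    Finset.prod_congr rfl fun n _ ↦ by rw [hy]; ring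
  simp only [Function.comp]
  rw [e1, e2, hfin]
  have hzero : ∀ n : ℤ, d < n.natAbs → ∀ g, coeff d (g * t n) = 0 := by
    intro n hn g
    refine X_pow_dvd_iff.mp ?_ d hn
    exact dvd_mul_of_dvd_right (dvd_mul_of_dvd_right
      (pow_dvd_pow _ (natAbs_le_theta_exponent ha hb n)) _) _
  have hsum : coeff d (theta c a b) = ∑ n ∈ Finset.Icc (-N : ℤ) (N + 1), coeff d (t n) := by
    have h1 := (hasSum_iff_hasSum_coeff ℤ).mp (summable_theta c ha hb).hasSum d
    rw [theta, ← h1.tsum_eq]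
    refine tsum_eq_sum fun n hn ↦ ?_
    rw [← one_mul (C _ * _)]
    refine hzero n ?_ 1
    rw [Finset.mem_Icc] at hn
    lia
  rw [hsum, Finset.mul_sum, map_sum]
  refine Finset.sum_bij' (fun p _ ↦ (p.1 - N : ℤ))
    (fun n _ ↦ ((n + N).toNat, (N + 1 - n).toNat)) ?_ ?_ ?_ ?_ ?_
  · rintro ⟨m, k⟩ h
    rw [Finset.HasAntidiagonal.mem_antidiagonal] at h
    rw [Finset.mem_Icc]
    lia
  · intro n h
    rw [Finset.mem_Icc] at h
    rw [Finset.HasAntidiagonal.mem_antidiagonal]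
    lia
  · rintro ⟨m, k⟩ h
    rw [Finset.HasAntidiagonal.mem_antidiagonal] at h
    simp only [Prod.mk.injEq] at h ⊢
    lia
  · intro n h
    rw [Finset.mem_Icc] at h
    simp only
    lia
  · rintro ⟨m, k⟩ h
    rw [Finset.HasAntidiagonal.mem_antidiagonal] at h
    simp only at h ⊢
    rw [← neg_sub (m : ℤ) N, hterm, ← mul_assoc]
    by_cases hn : d < (m - N : ℤ).natAbs
    · rw [hzero _ hn, ← one_mul (t _), hzero _ hn]
    · obtain ⟨u, hu⟩ := X_pow_dvd_euler_mul_gaussBinom_sub_one hab (m := m) (j := k) (d := d + 1)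
        (by lia) (by lia)
      rw [sub_eq_iff_eq_add] at hu
      rw [hu, add_mul, one_mul, map_add, mul_assoc, X_pow_dvd_iff.mp (Dvd.intro _ rfl) d (by lia),
        zero_add]

/-! ### The theta functions φ and ψ as quotients of Euler products -/

/-- `φ(q) = ∑ q ^ (n ^ 2)` at `q = X ^ k`. -/
noncomputable def phi (k : ℕ) : ℤ⟦X⟧ := theta 1 k k

/-- `φ(-q)` at `q = X ^ k`, that is `∑ (-1) ^ n X ^ (k n ^ 2)`. -/
noncomputable def phiNeg (k : ℕ) : ℤ⟦X⟧ := theta (-1) k k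

/-- `ψ(q) = ∑ q ^ (n (2 n + 1))` at `q = X ^ k`. -/
noncomputable def psi (k : ℕ) : ℤ⟦X⟧ := theta 1 (3 * k) k

theorem qProd_one_odd_mul {k : ℕ} (hk : 0 < k) :
    qProd 1 (2 * k) k * euler k * euler (4 * k) = euler (2 * k) ^ 2 := by
  have h1 := qProd_mul_neg 1 (a := 2 * k) (by lia) k
  have h2 := euler_split_two (k := 2 * k) (by lia)
  rw [show 2 * (2 * k) = 4 * k by ring] at h1 h2
  norm_num at h1
  rw [euler_split_two hk]
  linear_combination euler (2 * k) * euler (4 * k) * h1 - euler (2 * k) * h2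

theorem phiNeg_mul_euler {k : ℕ} (hk : 0 < k) :
    phiNeg k * euler (2 * k) = euler k ^ 2 := by
  rw [phiNeg, ← triple_product (by norm_num) hk hk, ← two_mul, euler_split_two hk]
  ring

theorem phi_mul_euler {k : ℕ} (hk : 0 < k) :
    phi k * (euler k ^ 2 * euler (4 * k) ^ 2) = euler (2 * k) ^ 5 := by
  rw [phi, ← triple_product (by norm_num) hk hk, ← two_mul]
  have h := qProd_one_odd_mul hk
  calc _ = euler (2 * k) * (qProd 1 (2 * k) k * euler k * euler (4 * k)) ^ 2 := by ring
    _ = _ := by rw [h]; ring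

theorem psi_mul_euler {k : ℕ} (hk : 0 < k) : psi k * euler k = euler (2 * k) ^ 2 := by
  rw [psi, ← triple_product (by norm_num) (by lia) hk, ← qProd_one_odd_mul hk,
    qProd_dissect 1 (a := 2 * k) (by lia) k 2 two_pos, Fin.prod_univ_two]
  rw [show 3 * k + k = 4 * k by ring, show 2 * k * 2 = 4 * k by ring]
  simp only [Fin.val_zero, Fin.val_one, mul_zero, mul_one, zero_add]
  rw [show 2 * k + k = 3 * k by ring]
  ring

theorem theta_two_one_mul_euler {k : ℕ} (hk : 0 < k) :
    theta 1 (2 * k) k * (euler k * euler (6 * k)) = euler (2 * k) * euler (3 * k) ^ 2 := by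
  have h1 := qProd_dissect 1 hk k 3 (by norm_num)
  have h2 := qProd_one_mul_euler hk
  have h3 := qProd_one_mul_euler (a := 3 * k) (by lia)
  rw [Fin.prod_univ_three, mul_comm k 3] at h1
  rw [show 2 * (3 * k) = 6 * k by ring] at h3
  simp only [Fin.val_zero, Fin.val_one, Fin.val_two, mul_zero, mul_one, zero_add] at h1
  rw [show k * 2 + k = 3 * k by ring, show k + k = 2 * k by ring] at h1
  rw [← triple_product (by norm_num) (by lia) hk, show 2 * k + k = 3 * k by ring, ← h2, ← h3, h1]
  ring

theorem theta_neg_five_one_mul_euler {k : ℕ} (hk : 0 < k) :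
    theta (-1) (5 * k) k * (euler (2 * k) * euler (3 * k)) = euler k * euler (6 * k) ^ 2 := by
  have h1 := qProd_dissect (-1) (a := 2 * k) (by lia) k 3 (by norm_num)
  have h2 := euler_split_two hk
  have h3 := euler_split_two (k := 3 * k) (by lia)
  rw [Fin.prod_univ_three, show 2 * k * 3 = 6 * k by ring] at h1
  rw [show 2 * (3 * k) = 6 * k by ring] at h3
  simp only [Fin.val_zero, Fin.val_one, Fin.val_two, mul_zero, mul_one, zero_add] at h1
  rw [show 2 * k * 2 + k = 5 * k by ring, show 2 * k + k = 3 * k by ring] at h1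
  rw [← triple_product (by norm_num) (by lia) hk, show 5 * k + k = 6 * k by ring, h2, h3, h1]
  ring

theorem evalNegHom_euler_odd_mul {k : ℕ} (hk : Odd k) :
    evalNegHom (euler k) * (euler k * euler (4 * k)) = euler (2 * k) ^ 3 := by
  rw [evalNegHom_euler_odd hk]
  linear_combination euler (2 * k) * qProd_one_odd_mul hk.pos

theorem expand_theta (c : ℤ) {a b : ℕ} (ha : 0 < a) (hb : 0 < b) (m : ℕ) (hm : m ≠ 0) :
    expand m hm (theta c a b) = theta c (m * a) (m * b) := by
  rw [theta, (summable_theta c ha hb).map_tsum _ (continuous_expand m hm), theta]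
  refine tsum_congr fun n ↦ ?_
  rw [map_mul, expand_C, map_pow (expand m hm), expand_X, ← pow_mul]
  congr 2
  ring

theorem expand_phi {k : ℕ} (hk : 0 < k) (m : ℕ) (hm : m ≠ 0) :
    expand m hm (phi k) = phi (m * k) := expand_theta _ hk hk _ _

theorem expand_phiNeg {k : ℕ} (hk : 0 < k) (m : ℕ) (hm : m ≠ 0) :
    expand m hm (phiNeg k) = phiNeg (m * k) := expand_theta _ hk hk _ _

theorem expand_psi {k : ℕ} (hk : 0 < k) (m : ℕ) (hm : m ≠ 0) :
    expand m hm (psi k) = psi (m * k) := by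
  rw [psi, expand_theta _ (by lia) hk, psi, show m * (3 * k) = 3 * (m * k) by ring]

/-! ### Dissections of theta series -/

theorem tsum_int_dissect {f : ℤ → ℤ⟦X⟧} (hf : Summable f) (m : ℕ) (hm : 0 < m) :
    ∑' n, f n = ∑ r : Fin m, ∑' j : ℤ, f (m * j + r) := by
  have : NeZero m := ⟨hm.ne'⟩
  have h := hf.hasSum
  rw [← ((Equiv.prodComm _ _).trans (Int.divModEquiv m).symm).hasSum_iff] at h
  have hs : ∀ r : Fin m, Summable fun j : ℤ ↦ f (m * j + r) := fun r ↦ by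
    have h0 : ∀ d, (Function.support fun n ↦ coeff d (f n)).Finite := fun d ↦
      (summable_iff_summable_coeff ℤ).mp hf d |>.hasFiniteSupport_of_discreteTopology
    rw [summable_iff_summable_coeff]
    intro d
    refine summable_of_hasFiniteSupport ?_
    refine Set.Finite.of_finite_image (f := fun j : ℤ ↦ (m * j + r : ℤ))
      ((h0 d).subset ?_) ?_
    · rintro _ ⟨j, hj, rfl⟩
      exact hj
    · intro i _ j _ hij
      simpa [hm.ne'] using hij
  have h2 := h.prod_fiberwise (g := fun r : Fin m ↦ ∑' j : ℤ, f (m * j + r)) fun r ↦ by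
    convert (hs r).hasSum using 1
    funext n
    simp only [Function.comp, Equiv.trans_apply, Equiv.prodComm_apply, Prod.swap_prod_mk,
      Int.divModEquiv_symm_apply]
    congr 1
    ring
  exact h2.unique (hasSum_fintype _)

theorem theta_dissect (c : ℤ) {a b : ℕ} (ha : 0 < a) (hb : 0 < b) (m : ℕ) (hm : 0 < m) :
    theta c a b = ∑ r : Fin m, ∑' j : ℤ, (C (c ^ (m * j + r : ℤ).natAbs) *
      X ^ (a * triangular (m * j + r) + b * triangular (-(m * j + r))) : ℤ⟦X⟧) :=
  tsum_int_dissect (summable_theta c ha hb) m hm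

theorem neg_one_pow_natAbs (n : ℤ) : (-1 : ℤ) ^ n.natAbs = if Even n then 1 else -1 := by
  split_ifs with h
  · exact (Int.natAbs_even.mpr h).neg_one_pow
  · exact (Int.natAbs_odd.mpr (Int.not_even_iff_odd.mp h)).neg_one_pow

theorem tsum_eq_mul_theta {c : ℤ} {a b : ℕ} (ha : 0 < a) (hb : 0 < b) {σ : ℤ → ℤ} {e : ℤ → ℕ}
    (s : ℤ) (e₀ : ℕ) (hσ : ∀ j, σ j = s * c ^ j.natAbs)
    (he : ∀ j, e j = a * triangular j + b * triangular (-j) + e₀) :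
    ∑' j : ℤ, (C (σ j) * X ^ e j : ℤ⟦X⟧) = C s * X ^ e₀ * theta c a b := by
  rw [theta, ← (summable_theta c ha hb).tsum_mul_left]
  refine tsum_congr fun j ↦ ?_
  rw [hσ, he, map_mul, pow_add]
  ring

/-- Some residue classes match a theta series with the prescribed order of its two parameters only
after the index is reversed. -/
theorem tsum_eq_mul_theta_of_reflect {c : ℤ} {a b : ℕ} (ha : 0 < a) (hb : 0 < b) {σ : ℤ → ℤ}
    {e : ℤ → ℕ} (s : ℤ) (e₀ : ℕ) (hσ : ∀ j, σ (-1 - j) = s * c ^ j.natAbs)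
    (he : ∀ j, e (-1 - j) = a * triangular j + b * triangular (-j) + e₀) :
    ∑' j : ℤ, (C (σ j) * X ^ e j : ℤ⟦X⟧) = C s * X ^ e₀ * theta c a b := by
  rw [← tsum_eq_mul_theta ha hb s e₀ hσ he]
  exact ((Equiv.subLeft (-1 : ℤ)).tsum_eq fun j ↦ (C (σ j) * X ^ e j : ℤ⟦X⟧)).symm

/-- The classes 1 and 2 modulo 3 are exchanged by n → -n, whence the factor 2. -/
theorem phiNeg_one_dissect : phiNeg 1 = phiNeg 9 - 2 * X * theta (-1) 15 3 := by
  rw [phiNeg, theta_dissect _ one_pos one_pos 3 (by norm_num), Fin.sum_univ_three]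
  rw [tsum_eq_mul_theta (c := -1) (a := 9) (b := 9) (by norm_num) (by norm_num) 1 0,
    tsum_eq_mul_theta (c := -1) (a := 15) (b := 3) (by norm_num) (by norm_num) (-1) 1,
    tsum_eq_mul_theta_of_reflect (c := -1) (a := 15) (b := 3) (by norm_num) (by norm_num) (-1) 1]
  · simp [phiNeg]
    ring
  · intro j
    rw [neg_one_pow_natAbs, neg_one_pow_natAbs]
    simp only [Fin.val_two]
    grind
  · intro j
    simp only [Fin.val_two]
    zify
    linarith [two_mul_triangular (3 * (-1 - j) + 2), two_mul_triangular (-(3 * (-1 - j) + 2)),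
      two_mul_triangular j, two_mul_triangular (-j)]
  · intro j
    rw [neg_one_pow_natAbs, neg_one_pow_natAbs]
    simp only [Fin.val_one]
    grind
  · intro j
    simp only [Fin.val_one]
    zify
    linarith [two_mul_triangular (3 * j + 1), two_mul_triangular (-(3 * j + 1)),
      two_mul_triangular j, two_mul_triangular (-j)]
  · intro j
    rw [neg_one_pow_natAbs, neg_one_pow_natAbs]
    simp only [Fin.val_zero]
    grind
  · intro j
    simp only [Fin.val_zero]
    zify
    linarith [two_mul_triangular (3 * j + 0), two_mul_triangular (-(3 * j + 0)),
      two_mul_triangular j, two_mul_triangular (-j)]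

/-- Class 2 modulo 3 gives q ψ(q^9); classes 0 and 1 are the even-indexed and odd-indexed halves of
`theta 1 6 3`. -/
theorem psi_one_dissect : psi 1 = theta 1 6 3 + X * psi 9 := by
  have h1 : psi 1 = theta 1 21 15 + X ^ 3 * theta 1 33 3 + X * psi 9 := by
    rw [psi, theta_dissect _ (by norm_num) one_pos 3 (by norm_num), Fin.sum_univ_three]
    rw [tsum_eq_mul_theta (c := 1) (a := 21) (b := 15) (by norm_num) (by norm_num) 1 0,
      tsum_eq_mul_theta (c := 1) (a := 33) (b := 3) (by norm_num) (by norm_num) 1 3,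
      tsum_eq_mul_theta_of_reflect (c := 1) (a := 27) (b := 9) (by norm_num) (by norm_num) 1 1]
    · simp [psi]
    · simp
    · intro j
      simp only [Fin.val_two]
      zify
      linarith [two_mul_triangular (3 * (-1 - j) + 2), two_mul_triangular (-(3 * (-1 - j) + 2)),
        two_mul_triangular j, two_mul_triangular (-j)]
    · simp
    · intro j
      simp only [Fin.val_one]
      zify
      linarith [two_mul_triangular (3 * j + 1), two_mul_triangular (-(3 * j + 1)),
        two_mul_triangular j, two_mul_triangular (-j)]
    · simp
    · intro j
      simp only [Fin.val_zero]
      zify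
      linarith [two_mul_triangular (3 * j + 0), two_mul_triangular (-(3 * j + 0)),
        two_mul_triangular j, two_mul_triangular (-j)]
  have h2 : theta 1 6 3 = theta 1 21 15 + X ^ 3 * theta 1 33 3 := by
    rw [theta_dissect _ (by norm_num) (by norm_num) 2 (by norm_num), Fin.sum_univ_two]
    rw [tsum_eq_mul_theta (c := 1) (a := 21) (b := 15) (by norm_num) (by norm_num) 1 0,
      tsum_eq_mul_theta_of_reflect (c := 1) (a := 33) (b := 3) (by norm_num) (by norm_num) 1 3]
    · simp
    · simp
    · intro j
      simp only [Fin.val_one]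
      zify
      linarith [two_mul_triangular (2 * (-1 - j) + 1), two_mul_triangular (-(2 * (-1 - j) + 1)),
        two_mul_triangular j, two_mul_triangular (-j)]
    · simp
    · intro j
      simp only [Fin.val_zero]
      zify
      linarith [two_mul_triangular (2 * j + 0), two_mul_triangular (-(2 * j + 0)),
        two_mul_triangular j, two_mul_triangular (-j)]
  rw [h1, h2]

/-- Even n reassemble to φ(q^4). The classes 1 and 3 modulo 4 each run through the odd squares 8T +
1 with T triangular, and each gives q ψ(q^8). -/
theorem phi_one_dissect : phi 1 = phi 4 + 2 * X * psi 8 := by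
  have h4 : phi 4 = theta 1 16 16 + ∑' j : ℤ, (C (1 ^ (4 * j + (2 : Fin 4)).natAbs) *
      X ^ (1 * triangular (4 * j + (2 : Fin 4)) +
        1 * triangular (-(4 * j + (2 : Fin 4)))) : ℤ⟦X⟧) := by
    rw [phi, theta_dissect _ (by norm_num) (by norm_num) 2 (by norm_num), Fin.sum_univ_two]
    rw [tsum_eq_mul_theta (c := 1) (a := 16) (b := 16) (by norm_num) (by norm_num) 1 0]
    · simp only [map_one, pow_zero, mul_one, one_mul, one_pow]
      congr 1
      refine tsum_congr fun j ↦ ?_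
      congr 1
      have h2 : (((2 : Fin 4) : ℕ) : ℤ) = 2 := rfl
      rw [h2]
      simp only [Fin.val_one]
      zify
      linarith [two_mul_triangular (2 * j + 1), two_mul_triangular (-(2 * j + 1)),
        two_mul_triangular (4 * j + 2), two_mul_triangular (-(4 * j + 2))]
    · simp
    · intro j
      simp only [Fin.val_zero]
      zify
      linarith [two_mul_triangular (2 * j + 0), two_mul_triangular (-(2 * j + 0)),
        two_mul_triangular j, two_mul_triangular (-j)]
  rw [h4, phi, theta_dissect _ one_pos one_pos 4 (by norm_num), Fin.sum_univ_four]
  have h3 : (((3 : Fin 4) : ℕ) : ℤ) = 3 := rfl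
  push_cast
  rw [tsum_eq_mul_theta (c := 1) (a := 16) (b := 16) (by norm_num) (by norm_num) 1 0,
    tsum_eq_mul_theta (c := 1) (a := 24) (b := 8) (by norm_num) (by norm_num) 1 1,
    tsum_eq_mul_theta_of_reflect (σ := fun j ↦ 1 ^ (4 * j + (3 : Fin 4)).natAbs) (c := 1) (a := 24)
      (b := 8) (by norm_num) (by norm_num) 1 1]
  · simp [psi]
    ring
  · simp
  · intro j
    rw [h3]
    zify
    linarith [two_mul_triangular (4 * (-1 - j) + 3), two_mul_triangular (-(4 * (-1 - j) + 3)),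
      two_mul_triangular j, two_mul_triangular (-j)]
  · simp
  · intro j
    simp only [Fin.val_one]
    zify
    linarith [two_mul_triangular (4 * j + 1), two_mul_triangular (-(4 * j + 1)),
      two_mul_triangular j, two_mul_triangular (-j)]
  · simp
  · intro j
    simp only [Fin.val_zero]
    zify
    linarith [two_mul_triangular (4 * j + 0), two_mul_triangular (-(4 * j + 0)),
      two_mul_triangular j, two_mul_triangular (-j)]

/-! ### The product ψ(q) ψ(q^3) -/

theorem hasSum_theta_one {a b : ℕ} (ha : 0 < a) (hb : 0 < b) :
    HasSum (fun n : ℤ ↦ (X ^ (a * triangular n + b * triangular (-n)) : ℤ⟦X⟧)) (theta 1 a b) := by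
  have h := (summable_theta 1 ha hb).hasSum
  simpa [theta] using h

theorem hasSum_theta_one_mul {a b a' b' : ℕ} (ha : 0 < a) (hb : 0 < b) (ha' : 0 < a')
    (hb' : 0 < b') :
    HasSum (fun p : ℤ × ℤ ↦ (X ^ ((a * triangular p.1 + b * triangular (-p.1)) +
      (a' * triangular p.2 + b' * triangular (-p.2))) : ℤ⟦X⟧)) (theta 1 a b * theta 1 a' b') := by
  have hs : Summable fun p : ℤ × ℤ ↦ (X ^ ((a * triangular p.1 + b * triangular (-p.1)) +
      (a' * triangular p.2 + b' * triangular (-p.2))) : ℤ⟦X⟧) := by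
    have h := summable_C_mul_X_pow (fun _ : ℤ × ℤ ↦ 1)
      (fun p ↦ (a * triangular p.1 + b * triangular (-p.1)) +
      (a' * triangular p.2 + b' * triangular (-p.2))) fun d ↦ by
        refine ((finite_natAbs_le d).prod (finite_natAbs_le d)).subset fun p hp ↦ ?_
        have h1 := natAbs_le_theta_exponent ha hb p.1
        have h2 := natAbs_le_theta_exponent ha' hb' p.2
        simp only [Set.mem_prod, Set.mem_ofPred_eq] at hp ⊢
        lia
    simpa using h
  have h := (hasSum_theta_one ha hb).mul (hasSum_theta_one ha' hb') (by simpa [pow_add] using hs)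
  simpa [pow_add] using h

/-- The lattice of index pairs (a, b) is split by the parity of a - b. On each half, completing the
square diagonalises the exponent a(2a+1) + 3b(2b+1). -/
theorem psi_one_mul_psi_three :
    psi 1 * psi 3 = psi 4 * phi 6 + X * (phi 2 * psi 12) := by
  -- With a = b + 2w the exponent depends on b through b + w/2. For odd w this is a half-integer,
  -- and the reflection j → -1 - j restores the form 4j(2j+1) + 6w^2.
  let g₁ : ℤ × ℤ → ℤ × ℤ := fun p ↦
    let b := if Even p.2 then p.1 - p.2 / 2 else -p.1 - 1 - p.2 / 2
    (b + 2 * p.2, b)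
  let g₂ : ℤ × ℤ → ℤ × ℤ := fun p ↦
    if Even p.1 then (p.1 / 2 + p.2 + 2 * (-2 * p.2 - 1) + 1, p.1 / 2 + p.2)
    else (p.1 / 2 - p.2 + 2 * (2 * p.2) + 1, p.1 / 2 - p.2)
  have hg₁ : Function.Injective g₁ := by
    rintro ⟨j, w⟩ ⟨j', w'⟩ h
    simp only [g₁, Prod.mk.injEq] at h ⊢
    have hw : w = w' := by lia
    subst hw
    obtain ⟨-, h⟩ := h
    split_ifs at h <;> lia
  have hg₂ : Function.Injective g₂ := by
    rintro ⟨w, i⟩ ⟨w', i'⟩ h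
    simp only [g₂] at h
    simp only [Prod.mk.injEq]
    split_ifs at h <;> simp only [Prod.mk.injEq] at h <;> grind
  have hr₁ : Set.range g₁ = {p | Even (p.1 - p.2)} := by
    ext ⟨a, b⟩
    simp only [Set.mem_range, Set.mem_ofPred_eq]
    constructor
    · rintro ⟨⟨j, w⟩, h⟩
      simp only [g₁, Prod.mk.injEq] at h
      exact ⟨w, by lia⟩
    · rintro ⟨w, hw⟩
      by_cases h : Even w
      · refine ⟨(b + w / 2, w), ?_⟩
        simp only [g₁, if_pos h, Prod.mk.injEq]
        lia
      · refine ⟨(-b - 1 - w / 2, w), ?_⟩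
        simp only [g₁, if_neg h, Prod.mk.injEq]
        lia
  have hr₂ : Set.range g₂ = {p | Even (p.1 - p.2)}ᶜ := by
    ext ⟨a, b⟩
    simp only [Set.mem_range, Set.mem_compl_iff, Set.mem_ofPred_eq, Int.not_even_iff_odd]
    constructor
    · rintro ⟨⟨w, i⟩, h⟩
      simp only [g₂] at h
      split_ifs at h <;> simp only [Prod.mk.injEq] at h <;> grind
    · rintro ⟨z, hz⟩
      rcases Int.even_or_odd' z with ⟨i, hi | hi⟩
      · refine ⟨(2 * (b + i) + 1, i), ?_⟩
        have h : ¬ Even (2 * (b + i) + 1) := by simp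
        simp only [g₂, if_neg h, Prod.mk.injEq]
        lia
      · refine ⟨(2 * (b + i + 1), -i - 1), ?_⟩
        have h : Even (2 * (b + i + 1)) := by simp
        simp only [g₂, if_pos h, Prod.mk.injEq]
        lia
  have hL := hasSum_theta_one_mul (a := 3 * 1) (b := 1) (a' := 3 * 3) (b' := 3) (by norm_num)
    (by norm_num) (by norm_num) (by norm_num)
  refine hL.unique (HasSum.add_isCompl (s := Set.range g₁) (t := Set.range g₂) ?_ ?_ ?_)
  · rw [hr₁, hr₂]
    exact isCompl_compl
  · refine (hg₁.hasSum_range_iff (f := fun p : ℤ × ℤ ↦ (X ^ ((3 * 1 * triangular p.1 +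
      1 * triangular (-p.1)) + (3 * 3 * triangular p.2 + 3 * triangular (-p.2))) : ℤ⟦X⟧))).mpr ?_
    refine (congrArg (fun f ↦ HasSum f (psi 4 * phi 6)) ?_).mpr
      (hasSum_theta_one_mul (a := 3 * 4) (b := 4) (a' := 6) (b' := 6) (by norm_num)
      (by norm_num) (by norm_num) (by norm_num))
    funext ⟨j, w⟩
    simp only [Function.comp]
    congr 1
    rcases Int.even_or_odd' w with ⟨r, rfl | rfl⟩
    · have h : g₁ (j, 2 * r) = (j - r + 2 * (2 * r), j - r) := by
        simp [g₁]
      rw [h]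
      zify
      linarith [two_mul_triangular (j - r + 2 * (2 * r)),
        two_mul_triangular (-(j - r + 2 * (2 * r))), two_mul_triangular (j - r),
        two_mul_triangular (-(j - r)), two_mul_triangular j, two_mul_triangular (-j),
        two_mul_triangular (2 * r), two_mul_triangular (-(2 * r))]
    · have h : g₁ (j, 2 * r + 1) = (-j - 1 - r + 2 * (2 * r + 1), -j - 1 - r) := by
        have h1 : (2 * r + 1) / 2 = r := by lia
        simp [g₁, h1]
      rw [h]
      zify
      linarith [two_mul_triangular (-j - 1 - r + 2 * (2 * r + 1)),
        two_mul_triangular (-(-j - 1 - r + 2 * (2 * r + 1))), two_mul_triangular (-j - 1 - r),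
        two_mul_triangular (-(-j - 1 - r)), two_mul_triangular j, two_mul_triangular (-j),
        two_mul_triangular (2 * r + 1), two_mul_triangular (-(2 * r + 1))]
  · refine (hg₂.hasSum_range_iff (f := fun p : ℤ × ℤ ↦ (X ^ ((3 * 1 * triangular p.1 +
      1 * triangular (-p.1)) + (3 * 3 * triangular p.2 + 3 * triangular (-p.2))) : ℤ⟦X⟧))).mpr ?_
    refine (congrArg (fun f ↦ HasSum f (X * (phi 2 * psi 12))) ?_).mpr
      ((hasSum_theta_one_mul (a := 2) (b := 2) (a' := 3 * 12) (b' := 12) (by norm_num)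
      (by norm_num) (by norm_num) (by norm_num)).mul_left X)
    funext ⟨w, i⟩
    simp only [Function.comp]
    rw [← pow_succ']
    congr 1
    rcases Int.even_or_odd' w with ⟨r, rfl | rfl⟩
    · have h : g₂ (2 * r, i) = (r + i + 2 * (-2 * i - 1) + 1, r + i) := by
        simp [g₂]
      rw [h]
      zify
      linarith [two_mul_triangular (r + i + 2 * (-2 * i - 1) + 1),
        two_mul_triangular (-(r + i + 2 * (-2 * i - 1) + 1)), two_mul_triangular (r + i),
        two_mul_triangular (-(r + i)), two_mul_triangular i, two_mul_triangular (-i),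
        two_mul_triangular (2 * r), two_mul_triangular (-(2 * r))]
    · have h : g₂ (2 * r + 1, i) = (r - i + 2 * (2 * i) + 1, r - i) := by
        have h1 : (2 * r + 1) / 2 = r := by lia
        simp [g₂, h1]
      rw [h]
      zify
      linarith [two_mul_triangular (r - i + 2 * (2 * i) + 1),
        two_mul_triangular (-(r - i + 2 * (2 * i) + 1)), two_mul_triangular (r - i),
        two_mul_triangular (-(r - i)), two_mul_triangular i, two_mul_triangular (-i),
        two_mul_triangular (2 * r + 1), two_mul_triangular (-(2 * r + 1))]

/-! ### The generating function -/

theorem hasProd_euler {k : ℕ} (hk : 0 < k) :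
    HasProd (fun n : ℕ ↦ (1 - X ^ (k * (n + 1)) : ℤ⟦X⟧)) (euler k) := by
  refine (congrArg (fun f ↦ HasProd f (euler k)) ?_).mpr (hasProd_qProd (-1) hk k)
  funext n
  simp [sub_eq_add_neg, mul_add]

/-- Padding with factors 1 indexes the product by all part sizes, so that it can be compared factor
by factor with the others. -/
theorem hasProd_euler_mul {k m : ℕ} (hk : 0 < k) (hm : 0 < m) :
    HasProd (fun n : ℕ ↦ (if m ∣ n + 1 then 1 - X ^ (k * (n + 1)) else 1 : ℤ⟦X⟧))
      (euler (k * m)) := by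
  have hinj : Function.Injective fun n : ℕ ↦ m * n + (m - 1) := by
    intro a b h
    simp only [Nat.add_right_cancel_iff] at h
    exact Nat.eq_of_mul_eq_mul_left hm h
  rw [← hinj.hasProd_iff]
  · refine (congrArg (fun f ↦ HasProd f (euler (k * m))) ?_).mpr
      (hasProd_euler (Nat.mul_pos hk hm))
    funext n
    have h : m * n + (m - 1) + 1 = m * (n + 1) := by
      rw [mul_add]
      lia
    simp only [Function.comp, h, dvd_mul_right, if_true, mul_assoc]
  · intro n hn
    rw [if_neg]
    rintro ⟨r, hr⟩
    apply hn
    obtain ⟨r, rfl⟩ : ∃ s, r = s + 1 := ⟨r - 1, by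
      rcases r with _ | r
      · simp at hr
      · simp⟩
    refine ⟨r, ?_⟩
    rw [mul_add] at hr
    simp only
    lia

/-- A part size not divisible by l contributes a geometric sum of t terms, which multiplication by 1
- q^i turns into 1 - q^(ti); a part size divisible by l contributes 1. The identity then holds
factor by factor. -/
theorem genFun_regularDistinct {l t : ℕ} (hl : 0 < l) (ht : 0 < t) :
    (PowerSeries.mk fun n ↦ (RD l t n : ℤ)) * euler 1 * euler (t * l) = euler l * euler t := by
  have hR : HasProd (fun i : ℕ ↦ if l ∣ i + 1 then 1 else
      ∑ j ∈ Finset.range t, (X : ℤ⟦X⟧) ^ ((i + 1) * j))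
      (PowerSeries.mk fun n ↦ (RD l t n : ℤ)) := by
    convert! Nat.Partition.hasProd_genFun (fun i c ↦ if ¬ l ∣ i ∧ c < t then (1 : ℤ) else 0) using 1
    · ext1 i
      by_cases h : l ∣ i + 1
      · simp only [h, not_true_eq_false, false_and, if_true, if_false]
        exact (add_eq_left.mpr ((tsum_congr fun _ ↦ zero_smul ℤ _).trans tsum_zero)).symm
      · rw [if_neg h, Finset.sum_range_eq_add_Ico _ ht, Finset.sum_Ico_eq_sum_range]
        refine congrArg₂ (· + ·) (by simp) ?_
        trans ∑ k ∈ Finset.range (t - 1), (if k + 1 < t then (1 : ℤ) else 0) •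
          (X : ℤ⟦X⟧) ^ ((i + 1) * (k + 1))
        · refine Finset.sum_congr rfl fun b hn ↦ ?_
          rw [add_comm 1 b]
          have : b + 1 < t := by
            rw [Finset.mem_range] at hn
            lia
          simp [this]
        · simp only [h, not_false_eq_true, true_and]
          refine (tsum_eq_sum fun b hb ↦ smul_eq_zero_of_left ?_ _).symm
          rw [if_neg]
          rw [Finset.mem_range] at hb
          lia
    · simp_rw [Nat.Partition.genFun, RD, regularDistinct, Finset.card_filter, Finsupp.prod,
        Finset.prod_boole]
      simp [forall_and]
  have h1 := (hR.mul (hasProd_euler one_pos)).mul (hasProd_euler_mul ht hl)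
  have h2 := (hasProd_euler_mul one_pos hl).mul (hasProd_euler ht)
  rw [one_mul] at h2
  refine h1.unique ((congrArg (fun f ↦ HasProd f (euler l * euler t)) ?_).mpr h2)
  funext i
  split_ifs
  · rw [one_mul]
  · rw [mul_one, one_mul, one_mul]
    simp_rw [pow_mul]
    rw [geom_sum_mul_neg, ← pow_mul, ← pow_mul, mul_comm]

/-! ### The odd part of the generating function -/

theorem coeff_X_mul_expand_two (f : ℤ⟦X⟧) (n : ℕ) :
    coeff (2 * n + 1) (X * expand 2 two_ne_zero f) = coeff n f := by
  rw [coeff_succ_X_mul, coeff_expand_mul]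

theorem coeff_expand_two_odd (f : ℤ⟦X⟧) (n : ℕ) :
    coeff (2 * n + 1) (expand 2 two_ne_zero f) = 0 :=
  coeff_expand_of_not_dvd _ _ _ (by lia)

/-- Letters prefixed by s stand for images under q → -q, and y for that of `theta 1 6 3`. The
difference r - r(-q) is a multiple of φ(-q^2) φ(-q^9) - φ(-q) φ(-q^18) (`k₃`). The 3-dissections of
φ(-q) and φ(-q^2) extract 2q from it (`k₁`), and the remaining factor is recognised as the
3-dissection of ψ(-q) (`k₂`). A field is used so that Euler products can be divided out. -/
theorem odd_part_identity_field {K : Type*} [Field K]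
    {x e₁ e₂ e₃ e₄ e₆ e₉ e₁₂ e₁₈ e₃₆ s₁ s₃ s₉ r sr p₁ p₂ p₉ p₁₈ w₃ w₆ y sy₁ sy₉ : K}
    (n₁ : e₁ ≠ 0) (n₂ : e₂ ≠ 0) (n₃ : e₃ ≠ 0) (n₄ : e₄ ≠ 0) (n₆ : e₆ ≠ 0) (n₉ : e₉ ≠ 0)
    (n₁₂ : e₁₂ ≠ 0) (n₁₈ : e₁₈ ≠ 0) (n₃₆ : e₃₆ ≠ 0)
    (hr : r * e₁ * e₃₆ = e₄ * e₉) (hsr : sr * s₁ * e₃₆ = e₄ * s₉)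
    (hs₁ : s₁ * (e₁ * e₄) = e₂ ^ 3) (hs₃ : s₃ * (e₃ * e₁₂) = e₆ ^ 3)
    (hs₉ : s₉ * (e₉ * e₃₆) = e₁₈ ^ 3)
    (hp₁ : p₁ * e₂ = e₁ ^ 2) (hp₂ : p₂ * e₄ = e₂ ^ 2) (hp₉ : p₉ * e₁₈ = e₉ ^ 2)
    (hp₁₈ : p₁₈ * e₃₆ = e₁₈ ^ 2)
    (hw₃ : w₃ * (e₆ * e₉) = e₃ * e₁₈ ^ 2) (hw₆ : w₆ * (e₁₂ * e₁₈) = e₆ * e₃₆ ^ 2)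
    (hy : y * (s₃ * e₁₈) = e₆ * s₉ ^ 2) (hsy₁ : sy₁ * s₁ = e₂ ^ 2) (hsy₉ : sy₉ * s₉ = e₁₈ ^ 2)
    (d₁ : p₁ = p₉ - 2 * x * w₃) (d₂ : p₂ = p₁₈ - 2 * x ^ 2 * w₆) (d : sy₁ = y - x * sy₉) :
    (r - sr) * (e₂ ^ 3 * e₁₂) = 2 * x * (e₄ ^ 3 * e₆) := by
  have hs₁' : s₁ = e₂ ^ 3 / (e₁ * e₄) := by rw [← hs₁]; field_simp
  have hs₃' : s₃ = e₆ ^ 3 / (e₃ * e₁₂) := by rw [← hs₃]; field_simp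
  have hs₉' : s₉ = e₁₈ ^ 3 / (e₉ * e₃₆) := by rw [← hs₉]; field_simp
  have hr' : r = e₄ * e₉ / (e₁ * e₃₆) := by rw [← hr]; field_simp
  have hp₁' : p₁ = e₁ ^ 2 / e₂ := by rw [← hp₁]; field_simp
  have hp₂' : p₂ = e₂ ^ 2 / e₄ := by rw [← hp₂]; field_simp
  have hp₉' : p₉ = e₉ ^ 2 / e₁₈ := by rw [← hp₉]; field_simp
  have hp₁₈' : p₁₈ = e₁₈ ^ 2 / e₃₆ := by rw [← hp₁₈]; field_simp
  have hw₃' : w₃ = e₃ * e₁₈ ^ 2 / (e₆ * e₉) := by rw [← hw₃]; field_simp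
  have hw₆' : w₆ = e₆ * e₃₆ ^ 2 / (e₁₂ * e₁₈) := by rw [← hw₆]; field_simp
  have m₁ : s₁ ≠ 0 := by rw [hs₁']; positivity
  have m₃ : s₃ ≠ 0 := by rw [hs₃']; positivity
  have m₉ : s₉ ≠ 0 := by rw [hs₉']; positivity
  have hsr' : sr = e₄ * s₉ / (s₁ * e₃₆) := by rw [← hsr]; field_simp
  have hy' : y = e₆ * s₉ ^ 2 / (s₃ * e₁₈) := by rw [← hy]; field_simp
  have hsy₁' : sy₁ = e₂ ^ 2 / s₁ := by rw [← hsy₁]; field_simp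
  have hsy₉' : sy₉ = e₁₈ ^ 2 / s₉ := by rw [← hsy₉]; field_simp
  have k₁ : p₂ * p₉ - p₁ * p₁₈ = 2 * x * (w₃ * p₁₈ - x * w₆ * p₉) := by
    rw [d₁, d₂]; ring
  have k₂ : w₃ * p₁₈ - x * w₆ * p₉ = e₆ * e₉ * e₃₆ / (e₁₂ * e₁₈) * sy₁ := by
    rw [d, hy', hsy₉', hw₃', hw₆', hp₉', hp₁₈', hs₃', hs₉']
    field_simp
  have k₃ : r - sr = e₄ ^ 2 * e₁₈ / (e₃₆ * e₁ * e₉ * e₂ ^ 2) * (p₂ * p₉ - p₁ * p₁₈) := by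
    rw [hr', hsr', hp₁', hp₂', hp₉', hp₁₈', hs₁', hs₉']
    field_simp
  rw [k₃, k₁, k₂, hsy₁', hs₁']
  field_simp

theorem algebraMap_fractionRing_injective :
    Function.Injective (algebraMap ℤ⟦X⟧ (FractionRing ℤ⟦X⟧)) :=
  IsFractionRing.injective _ _

theorem algebraMap_euler_ne_zero {k : ℕ} (hk : 0 < k) :
    algebraMap ℤ⟦X⟧ (FractionRing ℤ⟦X⟧) (euler k) ≠ 0 :=
  (map_ne_zero_iff _ algebraMap_fractionRing_injective).mpr (euler_ne_zero hk)

theorem coeff_evalNegHom_odd (f : ℤ⟦X⟧) (n : ℕ) :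
    coeff (2 * n + 1) (evalNegHom f) = -coeff (2 * n + 1) f := by
  rw [evalNegHom, coeff_rescale]
  simp [pow_succ, pow_mul]

theorem sub_evalNegHom_genFun {r : ℤ⟦X⟧} (hr : r * euler 1 * euler 36 = euler 4 * euler 9) :
    (r - evalNegHom r) * (euler 2 ^ 3 * euler 12) = 2 * X * (euler 4 ^ 3 * euler 6) := by
  set i := algebraMap ℤ⟦X⟧ (FractionRing ℤ⟦X⟧)
  apply algebraMap_fractionRing_injective
  have tr : ∀ {a b : ℤ⟦X⟧}, a = b → i a = i b := fun h ↦ congrArg i h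
  have hsr := congrArg evalNegHom hr
  simp only [map_mul] at hsr
  rw [evalNegHom_euler_even (k := 36) (by norm_num) (by decide),
    evalNegHom_euler_even (k := 4) (by norm_num) (by decide)] at hsr
  have hw₃ := theta_neg_five_one_mul_euler (k := 3) (by norm_num)
  have hw₆ := theta_neg_five_one_mul_euler (k := 6) (by norm_num)
  have hy := congrArg evalNegHom (theta_two_one_mul_euler (k := 3) (by norm_num))
  simp only [map_mul, map_pow] at hy
  norm_num at hy
  rw [evalNegHom_euler_even (k := 18) (by norm_num) (by decide),
    evalNegHom_euler_even (k := 6) (by norm_num) (by decide)] at hy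
  have hsy₁ := congrArg evalNegHom (psi_mul_euler (k := 1) (by norm_num))
  simp only [map_mul, map_pow] at hsy₁
  norm_num at hsy₁
  rw [evalNegHom_euler_even (k := 2) (by norm_num) (by decide)] at hsy₁
  have hsy₉ := congrArg evalNegHom (psi_mul_euler (k := 9) (by norm_num))
  simp only [map_mul, map_pow] at hsy₉
  norm_num at hsy₉
  rw [evalNegHom_euler_even (k := 18) (by norm_num) (by decide)] at hsy₉
  have d₂ := congrArg (expand 2 two_ne_zero) phiNeg_one_dissect
  simp only [map_mul, map_sub, map_ofNat, expand_X] at d₂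
  rw [expand_phiNeg (by norm_num), expand_phiNeg (by norm_num),
    expand_theta _ (by norm_num) (by norm_num)] at d₂
  have d := congrArg evalNegHom psi_one_dissect
  simp only [map_mul, map_add, evalNegHom_X, neg_mul, ← sub_eq_add_neg] at d
  have key := odd_part_identity_field (K := FractionRing ℤ⟦X⟧) (x := i X)
    (algebraMap_euler_ne_zero one_pos) (algebraMap_euler_ne_zero (k := 2) (by norm_num))
    (algebraMap_euler_ne_zero (k := 3) (by norm_num))
    (algebraMap_euler_ne_zero (k := 4) (by norm_num))
    (algebraMap_euler_ne_zero (k := 6) (by norm_num))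
    (algebraMap_euler_ne_zero (k := 9) (by norm_num))
    (algebraMap_euler_ne_zero (k := 12) (by norm_num))
    (algebraMap_euler_ne_zero (k := 18) (by norm_num))
    (algebraMap_euler_ne_zero (k := 36) (by norm_num))
    (r := i r) (sr := i (evalNegHom r)) (s₁ := i (evalNegHom (euler 1)))
    (s₃ := i (evalNegHom (euler 3))) (s₉ := i (evalNegHom (euler 9)))
    (p₁ := i (phiNeg 1)) (p₂ := i (phiNeg 2)) (p₉ := i (phiNeg 9)) (p₁₈ := i (phiNeg 18))
    (w₃ := i (theta (-1) 15 3)) (w₆ := i (theta (-1) 30 6)) (y := i (evalNegHom (theta 1 6 3)))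
    (sy₁ := i (evalNegHom (psi 1))) (sy₉ := i (evalNegHom (psi 9)))
    (by simpa only [map_mul, map_pow] using tr hr)
    (by simpa only [map_mul, map_pow] using tr hsr)
    (by simpa only [map_mul, map_pow] using
      tr (evalNegHom_euler_odd_mul (k := 1) (by decide)))
    (by simpa only [map_mul, map_pow] using
      tr (evalNegHom_euler_odd_mul (k := 3) (by decide)))
    (by simpa only [map_mul, map_pow] using
      tr (evalNegHom_euler_odd_mul (k := 9) (by decide)))
    (by simpa only [map_mul, map_pow] using tr (phiNeg_mul_euler (k := 1) (by norm_num)))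
    (by simpa only [map_mul, map_pow] using tr (phiNeg_mul_euler (k := 2) (by norm_num)))
    (by simpa only [map_mul, map_pow] using tr (phiNeg_mul_euler (k := 9) (by norm_num)))
    (by simpa only [map_mul, map_pow] using tr (phiNeg_mul_euler (k := 18) (by norm_num)))
    (by simpa only [map_mul, map_pow] using tr hw₃)
    (by simpa only [map_mul, map_pow] using tr hw₆)
    (by simpa only [map_mul, map_pow] using tr hy)
    (by simpa only [map_mul, map_pow] using tr hsy₁)
    (by simpa only [map_mul, map_pow] using tr hsy₉)
    (by simpa only [map_mul, map_pow, map_sub, map_ofNat] using tr phiNeg_one_dissect)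
    (by simpa only [map_mul, map_pow, map_sub, map_ofNat] using tr d₂)
    (by simpa only [map_mul, map_sub] using tr d)
  simpa only [map_mul, map_pow, map_sub, map_ofNat] using key

theorem coeff_genFun_odd {r f : ℤ⟦X⟧} (hr : r * euler 1 * euler 36 = euler 4 * euler 9)
    (hf : f * (euler 1 ^ 3 * euler 6) = euler 2 ^ 3 * euler 3) (n : ℕ) :
    coeff (2 * n + 1) r = coeff n f := by
  have h1 := sub_evalNegHom_genFun hr
  have h2 := congrArg (expand 2 two_ne_zero) hf
  simp only [map_mul, map_pow] at h2
  rw [expand_euler (by norm_num), expand_euler (by norm_num), expand_euler (by norm_num),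
    expand_euler (by norm_num)] at h2
  norm_num at h2
  rw [← h2, ← mul_assoc (2 * X)] at h1
  have h3 := mul_right_cancel₀ (mul_ne_zero (pow_ne_zero 3 (euler_ne_zero (k := 2) (by norm_num)))
    (euler_ne_zero (k := 12) (by norm_num))) h1
  have h4 := congrArg (coeff (2 * n + 1)) h3
  rw [mul_assoc, map_sub, coeff_evalNegHom_odd, two_mul (X * _), map_add, coeff_X_mul_expand_two] at h4
  lia

/-! ### Congruences along arithmetic progressions -/

theorem C_dvd_iff {d : ℤ} {f : ℤ⟦X⟧} : C d ∣ f ↔ ∀ n, d ∣ coeff n f := by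
  constructor
  · rintro ⟨g, rfl⟩ n
    exact ⟨coeff n g, by rw [coeff_C_mul]⟩
  · intro h
    choose g hg using h
    exact ⟨PowerSeries.mk g, by ext n; rw [coeff_C_mul, coeff_mk, hg]⟩

/-- Frobenius over `ZMod p`: the coefficients are fixed, so the p-th power is the substitution q →
q^p. -/
theorem exists_pow_eq_expand_add (p : ℕ) [Fact p.Prime] (f : ℤ⟦X⟧) :
    ∃ g, f ^ p = expand p (Fact.out : p.Prime).ne_zero f + C (p : ℤ) * g := by
  have h : C (p : ℤ) ∣ f ^ p - expand p (Fact.out : p.Prime).ne_zero f := by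
    rw [C_dvd_iff]
    intro n
    rw [← ZMod.intCast_zmod_eq_zero_iff_dvd]
    have h1 := MvPowerSeries.map_frobenius_expand (R := ZMod p) p (Fact.out : p.Prime).ne_zero
      (f := map (Int.castRingHom (ZMod p)) f)
    rw [ZMod.frobenius_zmod] at h1
    change map (RingHom.id (ZMod p)) (expand p _ (map (Int.castRingHom (ZMod p)) f)) = _ at h1
    rw [PowerSeries.map_id, id, ← map_expand, ← map_pow] at h1
    have h2 := congrArg (coeff n) h1
    rw [coeff_map, coeff_map, eq_intCast, eq_intCast] at h2
    rw [map_sub, Int.cast_sub, h2, sub_self]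
  obtain ⟨g, hg⟩ := h
  exact ⟨g, by rw [← hg]; ring⟩

/-- The coefficients of `f` at the exponents `m n + r` are divisible by `d`. -/
def VanishesMod (d : ℤ) (m r : ℕ) (f : ℤ⟦X⟧) : Prop := ∀ n, d ∣ coeff (m * n + r) f

theorem VanishesMod.add {d : ℤ} {m r : ℕ} {f g : ℤ⟦X⟧} (hf : VanishesMod d m r f)
    (hg : VanishesMod d m r g) : VanishesMod d m r (f + g) := fun n ↦ by
  rw [map_add]
  exact dvd_add (hf n) (hg n)

theorem vanishesMod_C_mul (d : ℤ) (m r : ℕ) (f : ℤ⟦X⟧) : VanishesMod d m r (C d * f) := fun n ↦ by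
  rw [coeff_C_mul]
  exact dvd_mul_right _ _

theorem VanishesMod.C_mul {d : ℤ} {m r : ℕ} {f : ℤ⟦X⟧} (hf : VanishesMod d m r f) (e : ℤ) :
    VanishesMod (e * d) m r (C e * f) := fun n ↦ by
  rw [coeff_C_mul]
  exact mul_dvd_mul_left e (hf n)

theorem VanishesMod.X_mul {d : ℤ} {m r : ℕ} {f : ℤ⟦X⟧} (hf : VanishesMod d m r f) :
    VanishesMod d m (r + 1) (X * f) := fun n ↦ by
  rw [← add_assoc, coeff_succ_X_mul]
  exact hf n

theorem vanishesMod_expand {d : ℤ} {m r k : ℕ} (hk : k ≠ 0) (h : ∀ n, ¬ k ∣ m * n + r)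
    (f : ℤ⟦X⟧) : VanishesMod d m r (expand k hk f) := fun n ↦ by
  rw [coeff_expand_of_not_dvd _ _ _ (h n)]
  exact dvd_zero _

theorem VanishesMod.mul_expand {d : ℤ} {m r : ℕ} {f : ℤ⟦X⟧} (hf : VanishesMod d m r f)
    (hr : r < m) (hm : m ≠ 0) (g : ℤ⟦X⟧) : VanishesMod d m r (f * expand m hm g) := fun n ↦ by
  rw [coeff_mul]
  refine Finset.dvd_sum fun p hp ↦ ?_
  rw [Finset.HasAntidiagonal.mem_antidiagonal] at hp
  by_cases h : m ∣ p.2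
  · obtain ⟨k, hk⟩ := h
    have hkn : k ≤ n := by
      by_contra hlt
      have : m * (n + 1) ≤ m * k := Nat.mul_le_mul_left m (by lia)
      rw [mul_add] at this
      lia
    obtain ⟨j, rfl⟩ := Nat.exists_eq_add_of_le hkn
    have hp1 : p.1 = m * j + r := by
      rw [hk, mul_add] at hp
      lia
    rw [hp1]
    exact dvd_mul_of_dvd_left (hf j) _
  · rw [coeff_expand_of_not_dvd _ _ _ h, mul_zero]
    exact dvd_zero _

theorem expand_expand (a b : ℕ) (ha : a ≠ 0) (hb : b ≠ 0) (f : ℤ⟦X⟧) :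
    expand a ha (expand b hb f) = expand (a * b) (mul_ne_zero ha hb) f :=
  (expand_mul a ha b hb f).symm

theorem expand_injective (m : ℕ) (hm : m ≠ 0) : Function.Injective (expand m hm : ℤ⟦X⟧ → ℤ⟦X⟧) := by
  intro f g h
  ext n
  rw [← coeff_expand_mul m hm, h, coeff_expand_mul]

theorem evalNegHom_expand_two (f : ℤ⟦X⟧) :
    evalNegHom (expand 2 two_ne_zero f) = expand 2 two_ne_zero f := by
  ext n
  rw [evalNegHom, coeff_rescale]
  by_cases h : 2 ∣ n
  · rw [(even_iff_two_dvd.mpr h).neg_one_pow, one_mul]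
  · rw [coeff_expand_of_not_dvd _ _ _ h, mul_zero]

theorem psi_one_vanishesMod (d : ℤ) : VanishesMod d 3 2 (psi 1) := by
  rw [psi_one_dissect, show psi 9 = expand 3 three_ne_zero (psi 3) by
      rw [expand_psi (by norm_num)],
    show theta 1 6 3 = expand 3 three_ne_zero (theta 1 2 1) by
      rw [expand_theta _ (by norm_num) (by norm_num)]]
  refine VanishesMod.add (vanishesMod_expand _ (by lia) _) (VanishesMod.X_mul ?_)
  exact vanishesMod_expand _ (by lia) _

/-- 8k ≡ 4 modulo 6 forces k ≡ 2 modulo 3, a class that triangular numbers avoid. -/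
theorem psi_eight_vanishesMod (d : ℤ) : VanishesMod d 6 4 (psi 8) := by
  intro n
  rw [show psi 8 = expand 8 (by norm_num) (psi 1) by rw [expand_psi (by norm_num)]]
  by_cases h : 8 ∣ 6 * n + 4
  · obtain ⟨k, hk⟩ := h
    obtain ⟨j, rfl⟩ : ∃ j, k = 3 * j + 2 := ⟨k / 3, by lia⟩
    rw [hk, coeff_expand_mul]
    exact psi_one_vanishesMod d j
  · rw [coeff_expand_of_not_dvd _ _ _ h]
    exact dvd_zero _

/-! ### The quotient f modulo 3 and modulo 2 -/

theorem quotient_sub_one_dvd_three {f : ℤ⟦X⟧}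
    (hf : f * (euler 1 ^ 3 * euler 6) = euler 2 ^ 3 * euler 3) : C 3 ∣ f - 1 := by
  have := Fact.mk Nat.prime_three
  obtain ⟨g, hg⟩ := exists_pow_eq_expand_add 3 (euler 1)
  obtain ⟨h, hh⟩ := exists_pow_eq_expand_add 3 (euler 2)
  rw [expand_euler (by norm_num)] at hg hh
  norm_num at hg hh
  obtain ⟨I₃, hI₃⟩ := exists_mul_euler_eq_one (k := 3) (by norm_num)
  obtain ⟨I₆, hI₆⟩ := exists_mul_euler_eq_one (k := 6) (by norm_num)
  rw [hg, hh] at hf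
  rw [show (C 3 : ℤ⟦X⟧) = 3 from rfl]
  refine ⟨(h * euler 3 - f * g * euler 6) * I₃ * I₆, ?_⟩
  linear_combination I₃ * I₆ * hf - (f - 1) * hI₃ * (euler 6 * I₆) - (f - 1) * hI₆

/-- Since ψ(q) E_1 = E_2^2 and E_1^2 ≡ E_2 modulo 2, f ≡ ψ(q) E_3/E_6. The second factor is a series
in q^3, so the gap of ψ at 3n+2 survives. -/
theorem quotient_vanishesMod_two {f : ℤ⟦X⟧}
    (hf : f * (euler 1 ^ 3 * euler 6) = euler 2 ^ 3 * euler 3) : VanishesMod 2 3 2 f := by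
  obtain ⟨g, hg⟩ := exists_pow_eq_expand_add 2 (euler 1)
  rw [expand_euler (by norm_num)] at hg
  norm_num at hg
  obtain ⟨I₂, hI₂⟩ := exists_mul_euler_eq_one (k := 2) (by norm_num)
  have hI₆ := congrArg (expand 3 three_ne_zero) hI₂
  rw [map_mul, expand_euler (by norm_num), map_one] at hI₆
  norm_num at hI₆
  have h1 : f * (euler 1 ^ 2 * euler 6) = euler 2 * psi 1 * euler 3 := by
    apply mul_right_cancel₀ (euler_ne_zero one_pos)
    linear_combination hf - euler 2 * euler 3 * psi_mul_euler one_pos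
  have h2 : f = psi 1 * expand 3 three_ne_zero (euler 1 * I₂) +
      C 2 * (-(f * g * I₂)) := by
    rw [map_mul, expand_euler one_pos, show (C 2 : ℤ⟦X⟧) = 2 from rfl]
    rw [hg] at h1
    norm_num
    linear_combination I₂ * expand 3 three_ne_zero I₂ * h1 - (f + 2 * f * g * I₂) * hI₆ -
      (f * euler 6 * expand 3 three_ne_zero I₂ - psi 1 * euler 3 * expand 3 three_ne_zero I₂) * hI₂
  rw [h2]
  exact ((psi_one_vanishesMod 2).mul_expand (by norm_num) _ _).add (vanishesMod_C_mul _ _ _ _)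

/-! ### The self-similar 2-dissection of f -/

theorem evalNegHom_evalNegHom (f : ℤ⟦X⟧) : evalNegHom (evalNegHom f) = f := by
  ext n
  rw [evalNegHom, coeff_rescale, coeff_rescale, ← mul_assoc, ← mul_pow]
  simp

theorem evalNegHom_phi_one : evalNegHom (phi 1) = phiNeg 1 := by
  rw [phi, phiNeg, ← triple_product (by norm_num) one_pos one_pos,
    ← triple_product (by norm_num) one_pos one_pos, map_mul, map_mul,
    evalNegHom_euler_even (by norm_num) (by decide),
    evalNegHom_qProd_odd _ (by norm_num) (by decide) (by decide)]

theorem evalNegHom_phi_four : evalNegHom (phi 4) = phi 4 := by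
  rw [show phi 4 = expand 2 two_ne_zero (phi 2) by rw [expand_phi (by norm_num)],
    evalNegHom_expand_two]

theorem evalNegHom_psi_eight : evalNegHom (psi 8) = psi 8 := by
  rw [show psi 8 = expand 2 two_ne_zero (psi 4) by rw [expand_psi (by norm_num)],
    evalNegHom_expand_two]

theorem phiNeg_one_dissect_two : phiNeg 1 = phi 4 - 2 * X * psi 8 := by
  have h := congrArg evalNegHom phi_one_dissect
  rw [evalNegHom_phi_one, map_add, map_mul, map_mul, evalNegHom_X, evalNegHom_phi_four,
    evalNegHom_psi_eight, map_ofNat] at h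
  rw [h]
  ring

theorem phi_mul_phiNeg {k : ℕ} (hk : 0 < k) : phi k * phiNeg k = phiNeg (2 * k) ^ 2 := by
  have h₁ := euler_ne_zero hk
  have h₂ := euler_ne_zero (k := 2 * k) (by lia)
  have h₄ := euler_ne_zero (k := 4 * k) (by lia)
  have e₁ := phiNeg_mul_euler hk
  have e₂ := phiNeg_mul_euler (k := 2 * k) (by lia)
  rw [show 2 * (2 * k) = 4 * k by ring] at e₂
  have e₃ := phi_mul_euler hk
  have hM : euler k ^ 2 * euler (4 * k) ^ 2 * euler (2 * k) ≠ 0 := by positivity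
  apply mul_right_cancel₀ hM
  calc _ = (phi k * (euler k ^ 2 * euler (4 * k) ^ 2)) * (phiNeg k * euler (2 * k)) := by ring
    _ = euler (2 * k) ^ 4 * (euler k ^ 2 * euler (2 * k)) := by rw [e₃, e₁]; ring
    _ = ((phiNeg (2 * k) * euler (4 * k)) ^ 2) * (euler k ^ 2 * euler (2 * k)) := by rw [e₂]; ring
    _ = _ := by ring

theorem phi_mul_psi_two_mul {k : ℕ} (hk : 0 < k) : phi k * psi (2 * k) = psi k ^ 2 := by
  have h₁ := euler_ne_zero hk
  have h₂ := euler_ne_zero (k := 2 * k) (by lia)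
  have h₄ := euler_ne_zero (k := 4 * k) (by lia)
  have e₁ := psi_mul_euler hk
  have e₂ := psi_mul_euler (k := 2 * k) (by lia)
  rw [show 2 * (2 * k) = 4 * k by ring] at e₂
  have e₃ := phi_mul_euler hk
  have hM : euler k ^ 2 * euler (4 * k) ^ 2 * euler (2 * k) ≠ 0 := by positivity
  apply mul_right_cancel₀ hM
  calc _ = (phi k * (euler k ^ 2 * euler (4 * k) ^ 2)) * (psi (2 * k) * euler (2 * k)) := by ring
    _ = (euler (2 * k) ^ 2) ^ 2 * (euler (4 * k) ^ 2 * euler (2 * k)) := by rw [e₃, e₂]; ring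
    _ = (psi k * euler k) ^ 2 * (euler (4 * k) ^ 2 * euler (2 * k)) := by rw [e₁]
    _ = _ := by ring

/-- Inserting φ(±q) = φ(q^4) ± 2q ψ(q^8) into φ(q) φ(-q) = φ(-q^2)^2 gives a formula for φ(-q)^2
with q^2 in place of q; q → -q finishes. -/
theorem phi_one_sq : phi 1 ^ 2 = phi 2 ^ 2 + 4 * X * psi 4 ^ 2 := by
  have h1 : phiNeg 1 ^ 2 = phi 2 ^ 2 - 4 * X * psi 4 ^ 2 := by
    apply expand_injective 2 two_ne_zero
    have h := phi_mul_phiNeg one_pos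
    rw [phi_one_dissect, phiNeg_one_dissect_two] at h
    simp only [map_sub, map_mul, map_pow, map_ofNat, expand_X]
    rw [expand_phiNeg one_pos, expand_phi (by norm_num), expand_psi (by norm_num)]
    norm_num at h ⊢
    linear_combination -h
  have h2 := congrArg evalNegHom h1
  rw [← evalNegHom_phi_one, map_pow, evalNegHom_evalNegHom, map_sub, map_mul, map_mul,
    map_ofNat, evalNegHom_X, map_pow, map_pow,
    show phi 2 = expand 2 two_ne_zero (phi 1) by rw [expand_phi (by norm_num)],
    show psi 4 = expand 2 two_ne_zero (psi 2) by rw [expand_psi (by norm_num)],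
    evalNegHom_expand_two, evalNegHom_expand_two, expand_phi (by norm_num),
    expand_psi (by norm_num)] at h2
  norm_num at h2
  linear_combination h2

theorem phi_one_mul_phi_three_sub :
    phi 1 * phi 3 - 4 * X * (psi 2 * psi 6) = phiNeg 1 * phiNeg 3 := by
  have h3 := congrArg (expand 3 three_ne_zero) phi_one_dissect
  have hneg := congrArg (expand 3 three_ne_zero) phiNeg_one_dissect_two
  have h := congrArg (expand 2 two_ne_zero) psi_one_mul_psi_three
  simp only [map_add, map_sub, map_mul, map_ofNat, expand_X] at h3 hneg h
  rw [expand_phi (by norm_num), expand_phi (by norm_num), expand_psi (by norm_num)] at h3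
  rw [expand_phiNeg (by norm_num), expand_phi (by norm_num), expand_psi (by norm_num)] at hneg
  rw [expand_psi (by norm_num), expand_psi (by norm_num), expand_psi (by norm_num),
    expand_phi (by norm_num), expand_phi (by norm_num), expand_psi (by norm_num)] at h
  norm_num at h3 hneg h
  rw [h3, hneg, phi_one_dissect, phiNeg_one_dissect_two]
  linear_combination (-4 * X) * h

theorem psi_mul_evalNegHom_psi {k : ℕ} (hk : Odd k) :
    psi k * evalNegHom (psi k) = psi (2 * k) * phiNeg (2 * k) := by
  have hk0 := hk.pos
  have h₁ := euler_ne_zero hk0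
  have h₂ := euler_ne_zero (k := 2 * k) (by lia)
  have h₄ := euler_ne_zero (k := 4 * k) (by lia)
  have e₁ := psi_mul_euler hk0
  have e₂ := psi_mul_euler (k := 2 * k) (by lia)
  have e₃ := phiNeg_mul_euler (k := 2 * k) (by lia)
  rw [show 2 * (2 * k) = 4 * k by ring] at e₂ e₃
  have e₄ := congrArg evalNegHom e₁
  rw [map_mul, map_pow, evalNegHom_euler_even (k := 2 * k) (by lia) (by simp)] at e₄
  have e₅ := evalNegHom_euler_odd_mul hk
  have hs : evalNegHom (euler k) ≠ 0 := by
    intro h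
    rw [h, zero_mul] at e₅
    exact pow_ne_zero 3 h₂ e₅.symm
  have hM : euler k * evalNegHom (euler k) * euler (4 * k) ≠ 0 := by positivity
  apply mul_right_cancel₀ hM
  calc _ = (psi k * euler k) * (evalNegHom (psi k) * evalNegHom (euler k)) * euler (4 * k) := by
        ring
    _ = euler (2 * k) ^ 2 * (phiNeg (2 * k) * euler (4 * k)) * euler (4 * k) := by
      rw [e₁, e₄, e₃]
    _ = psi (2 * k) * phiNeg (2 * k) * (euler (2 * k) ^ 3) := by
      linear_combination (-euler (2 * k) ^ 2 * phiNeg (2 * k)) * e₂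
    _ = _ := by
      rw [← e₅]
      ring

/-- Write f = ψ(q)^3 E_6 / (ψ(q^3) E_2^3) and multiply above and below by ψ(-q) ψ(-q^3): the
denominator becomes even. In the numerator, ψ(q)^4 = φ(q)^2 ψ(q^2)^2, and both φ(q)^2 and ψ(-q)
ψ(-q^3) have known 2-dissections. The even part of their product collapses by `i₁` to give f(q^2)^2;
the odd part is the numerator of o. -/
theorem even_odd_identity_field {K : Type*} [Field K]
    {x f a o e₁ e₂ e₃ e₄ e₆ e₁₂ f₁ f₂ f₆ p₂ p₆ y₁ y₂ y₃ y₄ y₆ y₁₂ sy₁ sy₃ : K}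
    (n₁ : e₁ ≠ 0) (n₂ : e₂ ≠ 0) (n₃ : e₃ ≠ 0) (n₄ : e₄ ≠ 0) (n₆ : e₆ ≠ 0) (n₁₂ : e₁₂ ≠ 0)
    (hf : f * (e₁ ^ 3 * e₆) = e₂ ^ 3 * e₃) (ha : a * (e₂ ^ 3 * e₁₂) = e₄ ^ 3 * e₆)
    (ho : o * (e₁₂ * p₂ ^ 3) = 4 * y₄ ^ 3 * f₆ - f₂ ^ 3 * y₁₂)
    (hy₁ : y₁ * e₁ = e₂ ^ 2) (hy₂ : y₂ * e₂ = e₄ ^ 2) (hy₃ : y₃ * e₃ = e₆ ^ 2)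
    (hy₆ : y₆ * e₆ = e₁₂ ^ 2) (hp₂ : p₂ * e₄ = e₂ ^ 2) (hp₆ : p₆ * e₁₂ = e₆ ^ 2)
    (q₁ : f₁ ^ 2 = f₂ ^ 2 + 4 * x * y₄ ^ 2) (q₂ : f₁ * y₂ = y₁ ^ 2) (q₃ : f₂ * y₄ = y₂ ^ 2)
    (ds : sy₁ * sy₃ = y₄ * f₆ - x * (f₂ * y₁₂)) (m₁ : y₁ * sy₁ = y₂ * p₂)
    (m₃ : y₃ * sy₃ = y₆ * p₆) (i₁ : f₂ * f₆ - 4 * x ^ 2 * (y₄ * y₁₂) = p₂ * p₆) :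
    f = a ^ 2 + x * o := by
  have hy₁' : y₁ = e₂ ^ 2 / e₁ := by rw [← hy₁]; field_simp
  have hy₂' : y₂ = e₄ ^ 2 / e₂ := by rw [← hy₂]; field_simp
  have hy₃' : y₃ = e₆ ^ 2 / e₃ := by rw [← hy₃]; field_simp
  have hy₆' : y₆ = e₁₂ ^ 2 / e₆ := by rw [← hy₆]; field_simp
  have hp₂' : p₂ = e₂ ^ 2 / e₄ := by rw [← hp₂]; field_simp
  have hp₆' : p₆ = e₆ ^ 2 / e₁₂ := by rw [← hp₆]; field_simp
  have ha' : a = e₄ ^ 3 * e₆ / (e₂ ^ 3 * e₁₂) := by rw [← ha]; field_simp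
  have hf' : f = e₂ ^ 3 * e₃ / (e₁ ^ 3 * e₆) := by rw [← hf]; field_simp
  have k₁ : f * y₃ * e₂ ^ 3 = y₁ ^ 3 * e₆ := by
    rw [hf', hy₃', hy₁']
    field_simp
  have k₂ : f * e₂ ^ 3 * (y₂ * p₂ * (y₆ * p₆)) =
      y₂ ^ 2 * e₆ * (y₂ ^ 2 * (p₂ * p₆) + x * (o * (e₁₂ * p₂ ^ 3))) := by
    calc _ = f * y₃ * e₂ ^ 3 * (y₁ * (sy₁ * sy₃)) := by rw [← m₁, ← m₃]; ring
      _ = e₆ * (y₁ ^ 2) ^ 2 * (sy₁ * sy₃) := by rw [k₁]; ring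
      _ = e₆ * y₂ ^ 2 * (f₁ ^ 2) * (y₄ * f₆ - x * (f₂ * y₁₂)) := by rw [← q₂, ds]; ring
      _ = _ := by rw [q₁, ← i₁, ho, ← q₃]; ring
  have k₃ : f = y₂ ^ 2 * e₆ * (y₂ ^ 2 * (p₂ * p₆) + x * (o * (e₁₂ * p₂ ^ 3))) /
      (e₂ ^ 3 * (y₂ * p₂ * (y₆ * p₆))) := by
    have hne : e₂ ^ 3 * (y₂ * p₂ * (y₆ * p₆)) ≠ 0 := by
      rw [hy₂', hp₂', hy₆', hp₆']
      positivity
    rw [eq_div_iff hne, ← k₂]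
    ring
  rw [k₃, ha', hy₂', hp₂', hy₆', hp₆']
  field_simp

theorem quotient_dissect {f o : ℤ⟦X⟧} (hf : f * (euler 1 ^ 3 * euler 6) = euler 2 ^ 3 * euler 3)
    (ho : o * (euler 6 * phiNeg 1 ^ 3) = 4 * psi 2 ^ 3 * phi 3 - phi 1 ^ 3 * psi 6) :
    f = expand 2 two_ne_zero (f ^ 2) + X * expand 2 two_ne_zero o := by
  set i := algebraMap ℤ⟦X⟧ (FractionRing ℤ⟦X⟧)
  apply algebraMap_fractionRing_injective
  have tr : ∀ {a b : ℤ⟦X⟧}, a = b → i a = i b := fun h ↦ congrArg i h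
  have ha := congrArg (expand 2 two_ne_zero) hf
  simp only [map_mul, map_pow] at ha
  rw [expand_euler (by norm_num), expand_euler (by norm_num), expand_euler (by norm_num),
    expand_euler (by norm_num)] at ha
  have ho' := congrArg (expand 2 two_ne_zero) ho
  simp only [map_mul, map_pow, map_sub, map_ofNat] at ho'
  rw [expand_euler (by norm_num), expand_phiNeg (by norm_num), expand_psi (by norm_num),
    expand_phi (by norm_num), expand_phi (by norm_num), expand_psi (by norm_num)] at ho'
  have i₁ := congrArg (expand 2 two_ne_zero) phi_one_mul_phi_three_sub
  simp only [map_mul, map_sub, map_ofNat, expand_X] at i₁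
  rw [expand_phi (by norm_num), expand_phi (by norm_num), expand_psi (by norm_num),
    expand_psi (by norm_num), expand_phiNeg (by norm_num), expand_phiNeg (by norm_num)] at i₁
  have ds := congrArg evalNegHom psi_one_mul_psi_three
  rw [map_mul, map_add, map_mul, map_mul, map_mul, evalNegHom_X,
    show psi 4 = expand 2 two_ne_zero (psi 2) by rw [expand_psi (by norm_num)],
    show phi 6 = expand 2 two_ne_zero (phi 3) by rw [expand_phi (by norm_num)],
    show phi 2 = expand 2 two_ne_zero (phi 1) by rw [expand_phi (by norm_num)],
    show psi 12 = expand 2 two_ne_zero (psi 6) by rw [expand_psi (by norm_num)],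
    evalNegHom_expand_two, evalNegHom_expand_two, evalNegHom_expand_two, evalNegHom_expand_two,
    expand_psi (by norm_num), expand_phi (by norm_num), expand_phi (by norm_num),
    expand_psi (by norm_num), neg_mul, ← sub_eq_add_neg] at ds
  have key := even_odd_identity_field (K := FractionRing ℤ⟦X⟧) (x := i X)
    (algebraMap_euler_ne_zero one_pos) (algebraMap_euler_ne_zero (k := 2) (by norm_num))
    (algebraMap_euler_ne_zero (k := 3) (by norm_num))
    (algebraMap_euler_ne_zero (k := 4) (by norm_num))
    (algebraMap_euler_ne_zero (k := 6) (by norm_num))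
    (algebraMap_euler_ne_zero (k := 12) (by norm_num))
    (f := i f) (a := i (expand 2 two_ne_zero f)) (o := i (expand 2 two_ne_zero o))
    (f₁ := i (phi 1)) (f₂ := i (phi 2)) (f₆ := i (phi 6)) (p₂ := i (phiNeg 2))
    (p₆ := i (phiNeg 6)) (y₁ := i (psi 1)) (y₂ := i (psi 2)) (y₃ := i (psi 3))
    (y₄ := i (psi 4)) (y₆ := i (psi 6)) (y₁₂ := i (psi 12)) (sy₁ := i (evalNegHom (psi 1)))
    (sy₃ := i (evalNegHom (psi 3)))
    (by simpa only [map_mul, map_pow] using tr hf)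
    (by simpa only [map_mul, map_pow] using tr ha)
    (by simpa only [map_mul, map_pow, map_sub, map_ofNat] using tr ho')
    (by simpa only [map_mul, map_pow] using tr (psi_mul_euler (k := 1) (by norm_num)))
    (by simpa only [map_mul, map_pow] using tr (psi_mul_euler (k := 2) (by norm_num)))
    (by simpa only [map_mul, map_pow] using tr (psi_mul_euler (k := 3) (by norm_num)))
    (by simpa only [map_mul, map_pow] using tr (psi_mul_euler (k := 6) (by norm_num)))
    (by simpa only [map_mul, map_pow] using tr (phiNeg_mul_euler (k := 2) (by norm_num)))
    (by simpa only [map_mul, map_pow] using tr (phiNeg_mul_euler (k := 6) (by norm_num)))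
    (by simpa only [map_mul, map_pow, map_add, map_ofNat] using tr phi_one_sq)
    (by simpa only [map_mul, map_pow] using tr (phi_mul_psi_two_mul (k := 1) (by norm_num)))
    (by simpa only [map_mul, map_pow] using tr (phi_mul_psi_two_mul (k := 2) (by norm_num)))
    (by simpa only [map_mul, map_sub] using tr ds)
    (by simpa only [map_mul] using tr (psi_mul_evalNegHom_psi (k := 1) (by decide)))
    (by simpa only [map_mul] using tr (psi_mul_evalNegHom_psi (k := 3) (by decide)))
    (by simpa only [map_mul, map_pow, map_sub, map_ofNat] using tr i₁)
  simpa only [map_mul, map_pow, map_add] using key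

/-! ### The odd part o modulo 8 and modulo 4 -/

theorem odd_part_congruences {o : ℤ⟦X⟧}
    (ho : o * (euler 6 * phiNeg 1 ^ 3) = 4 * psi 2 ^ 3 * phi 3 - phi 1 ^ 3 * psi 6) :
    (∃ u w, o * euler 6 = expand 2 two_ne_zero u + C 4 * (X * (psi 8 * (-psi 6))) + C 8 * w) ∧
    ∃ w, o * euler 6 = -psi 6 + C 4 * w := by
  obtain ⟨g, hg⟩ := exists_pow_eq_expand_add 2 (euler 1)
  obtain ⟨h, hh⟩ := exists_pow_eq_expand_add 2 (psi 4)
  rw [expand_euler (by norm_num)] at hg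
  rw [expand_psi (by norm_num)] at hh
  norm_num at hg hh
  obtain ⟨I, hI⟩ := exists_mul_euler_eq_one (k := 2) (by norm_num)
  -- φ(-q) E_2 = E_1^2 ≡ E_2 modulo 2.
  have hp : ∃ s, phiNeg 1 = 1 + 2 * s := by
    refine ⟨g * I, ?_⟩
    linear_combination I * phiNeg_mul_euler one_pos + I * hg + (1 - phiNeg 1) * hI
  obtain ⟨s, hs⟩ := hp
  obtain ⟨s', hs'⟩ : ∃ s', phi 1 = 1 + 2 * s' := by
    refine ⟨s + 2 * X * psi 8, ?_⟩
    linear_combination hs + phi_one_dissect - phiNeg_one_dissect_two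
  have hs₂ := congrArg (expand 2 two_ne_zero) hs
  have hs₂' := congrArg (expand 2 two_ne_zero) hs'
  have hs₃ := congrArg (expand 3 three_ne_zero) hs'
  simp only [map_add, map_mul, map_one, map_ofNat] at hs₂ hs₂' hs₃
  rw [expand_phiNeg (by norm_num)] at hs₂
  rw [expand_phi (by norm_num)] at hs₂' hs₃
  norm_num at hs₂ hs₂' hs₃
  set s₂ := expand 2 two_ne_zero s
  set s₂' := expand 2 two_ne_zero s'
  set s₃ := expand 3 three_ne_zero s'
  have hprod := phi_mul_phiNeg one_pos
  norm_num at hprod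
  have hsq := phi_one_sq
  -- Multiplying `ho` by φ(-q) makes the left factor φ(-q)^4 = (1 + 2s)^4 ≡ 1 modulo 8. On the
  -- right, φ(q)^3 φ(-q) = (φ(q^2)^2 + 4q ψ(q^4)^2) φ(-q^2)^2, with ψ(q^4)^2 ≡ ψ(q^8) modulo 2.
  have key : o * euler 6 = 4 * psi 2 ^ 3 - phi 2 ^ 2 * phiNeg 2 ^ 2 * psi 6 +
      4 * (X * (psi 8 * (-psi 6))) +
      8 * (-(s + 3 * s ^ 2 + 4 * s ^ 3 + 2 * s ^ 4) * (o * euler 6) +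
        psi 2 ^ 3 * (s₃ + s + 2 * s * s₃) -
        X * (2 * (s₂ + s₂ ^ 2) * psi 8 + h + 4 * h * (s₂ + s₂ ^ 2)) * psi 6) := by
    have h1 : o * euler 6 * phiNeg 1 ^ 4 = 4 * psi 2 ^ 3 * (phi 3 * phiNeg 1) -
        phi 1 ^ 2 * (phi 1 * phiNeg 1) * psi 6 := by
      linear_combination phiNeg 1 * ho
    have h2 : phiNeg 2 ^ 2 = 1 + 4 * (s₂ + s₂ ^ 2) := by rw [hs₂]; ring
    have h3 : phi 1 ^ 2 * (phi 1 * phiNeg 1) = phi 2 ^ 2 * phiNeg 2 ^ 2 +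
        4 * X * (psi 8 + 2 * h) * (1 + 4 * (s₂ + s₂ ^ 2)) := by
      rw [hprod, hsq, hh, ← h2]
      ring
    rw [h3, hs, hs₃] at h1
    linear_combination h1
  obtain ⟨W, hW⟩ : ∃ W, o * euler 6 = 4 * psi 2 ^ 3 - phi 2 ^ 2 * phiNeg 2 ^ 2 * psi 6 +
      4 * (X * (psi 8 * (-psi 6))) + 8 * W := ⟨_, key⟩
  rw [show (C 4 : ℤ⟦X⟧) = 4 from rfl, show (C 8 : ℤ⟦X⟧) = 8 from rfl]
  constructor
  · refine ⟨4 * psi 1 ^ 3 - phi 1 ^ 2 * phiNeg 1 ^ 2 * psi 3, W, ?_⟩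
    simp only [map_sub, map_mul, map_pow, map_ofNat]
    rw [expand_psi (by norm_num), expand_phi (by norm_num), expand_phiNeg (by norm_num),
      expand_psi (by norm_num)]
    exact hW
  · refine ⟨psi 2 ^ 3 - (s₂' + s₂' ^ 2 + s₂ + s₂ ^ 2 + 4 * (s₂' + s₂' ^ 2) * (s₂ + s₂ ^ 2)) * psi 6 +
      X * (psi 8 * (-psi 6)) + 2 * W, ?_⟩
    rw [hs₂, hs₂'] at hW
    linear_combination hW

theorem exists_quotient : ∃ f : ℤ⟦X⟧, f * (euler 1 ^ 3 * euler 6) = euler 2 ^ 3 * euler 3 := by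
  obtain ⟨I₁, h₁⟩ := exists_mul_euler_eq_one (k := 1) (by norm_num)
  obtain ⟨I₆, h₆⟩ := exists_mul_euler_eq_one (k := 6) (by norm_num)
  refine ⟨euler 2 ^ 3 * euler 3 * I₁ ^ 3 * I₆, ?_⟩
  calc _ = euler 2 ^ 3 * euler 3 * (euler 1 * I₁) ^ 3 * (euler 6 * I₆) := by ring
    _ = _ := by rw [h₁, h₆]; ring

theorem exists_odd_part : ∃ o : ℤ⟦X⟧,
    o * (euler 6 * phiNeg 1 ^ 3) = 4 * psi 2 ^ 3 * phi 3 - phi 1 ^ 3 * psi 6 := by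
  obtain ⟨I₁, h₁⟩ := exists_mul_euler_eq_one (k := 1) (by norm_num)
  obtain ⟨I₆, h₆⟩ := exists_mul_euler_eq_one (k := 6) (by norm_num)
  have hp : phiNeg 1 * (euler 2 * I₁ ^ 2) = 1 := by
    calc _ = (phiNeg 1 * euler 2) * I₁ ^ 2 := by ring
      _ = (euler 1 * I₁) ^ 2 := by rw [show phiNeg 1 * euler 2 = _ from phiNeg_mul_euler one_pos]; ring
      _ = 1 := by rw [h₁, one_pow]
  refine ⟨(4 * psi 2 ^ 3 * phi 3 - phi 1 ^ 3 * psi 6) * I₆ * (euler 2 * I₁ ^ 2) ^ 3, ?_⟩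
  calc _ = (4 * psi 2 ^ 3 * phi 3 - phi 1 ^ 3 * psi 6) * (euler 6 * I₆) *
        (phiNeg 1 * (euler 2 * I₁ ^ 2)) ^ 3 := by ring
    _ = _ := by rw [h₆, hp]; ring

/-- Dividing by E_6 only multiplies by a series in q^6. Modulo 8, the even series misses 6n+5 and q
ψ(q^8) ψ(q^6) has no exponents there. -/
theorem odd_part_properties {o : ℤ⟦X⟧}
    (ho : o * (euler 6 * phiNeg 1 ^ 3) = 4 * psi 2 ^ 3 * phi 3 - phi 1 ^ 3 * psi 6) :
    VanishesMod 8 6 5 o ∧ ∃ v w, o = expand 6 (by norm_num) v + C 4 * w := by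
  obtain ⟨⟨u, w, h8⟩, w', h4⟩ := odd_part_congruences ho
  obtain ⟨I, hI⟩ := exists_mul_euler_eq_one one_pos
  have hI6 := congrArg (expand 6 (by norm_num)) hI
  rw [map_mul, expand_euler one_pos, map_one, mul_one] at hI6
  have h6 : psi 6 = expand 6 (by norm_num) (psi 1) := by rw [expand_psi (by norm_num)]
  constructor
  · have h : o = o * euler 6 * expand 6 (by norm_num) I := by
      rw [mul_assoc, hI6, mul_one]
    rw [h]
    refine VanishesMod.mul_expand ?_ (by norm_num) _ _
    rw [h8]
    refine VanishesMod.add (VanishesMod.add (vanishesMod_expand _ (by lia) _) ?_)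
      (vanishesMod_C_mul _ _ _ _)
    refine VanishesMod.C_mul (d := 2) ?_ 4
    refine VanishesMod.X_mul ?_
    rw [h6, ← map_neg]
    exact (psi_eight_vanishesMod 2).mul_expand (by norm_num) _ _
  · refine ⟨-(psi 1 * I), w' * expand 6 (by norm_num) I, ?_⟩
    rw [map_neg, map_mul, ← h6]
    linear_combination expand 6 (by norm_num) I * h4 - o * hI6

/-! ### The three progressions modulo 8 -/

theorem vanishesMod_of_dissect {f o : ℤ⟦X⟧}
    (h : f = expand 2 two_ne_zero (f ^ 2) + X * expand 2 two_ne_zero o)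
    (hf : VanishesMod 2 3 2 f) (ho : VanishesMod 8 6 5 o)
    (ho4 : ∃ v w, o = expand 6 (by norm_num) v + C 4 * w) :
    VanishesMod 8 12 11 f ∧ VanishesMod 8 24 14 f ∧ VanishesMod 8 48 44 f := by
  obtain ⟨v, w, hv⟩ := ho4
  have heven : ∀ n, coeff (2 * n) f = coeff n (f ^ 2) := by
    intro n
    conv_lhs => rw [h]
    rw [map_add, coeff_expand_mul]
    rcases n with _ | n
    · simp
    · rw [show 2 * (n + 1) = 2 * n + 1 + 1 by ring, coeff_succ_X_mul, coeff_expand_two_odd,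
        add_zero]
  have hodd : ∀ n, coeff (2 * n + 1) f = coeff n o := by
    intro n
    conv_lhs => rw [h]
    rw [map_add, coeff_expand_two_odd, coeff_X_mul_expand_two, zero_add]
  -- Squaring the dissection: the cross term is the odd part and carries a factor 2. Squaring again
  -- raises it to 4.
  have hsq : f ^ 2 = expand 2 two_ne_zero (f ^ 4 + X * o ^ 2) +
      X * expand 2 two_ne_zero (C 2 * (f ^ 2 * o)) := by
    conv_lhs => rw [h]
    simp only [map_add, map_mul, map_pow, expand_X, expand_C]
    rw [show (C 2 : ℤ⟦X⟧) = 2 from rfl]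
    ring
  have hsqodd : ∀ n, coeff (2 * n + 1) (f ^ 2) = 2 * coeff n (f ^ 2 * o) := by
    intro n
    rw [hsq, map_add, coeff_expand_two_odd, coeff_X_mul_expand_two, coeff_C_mul, ← hsq, zero_add]
  have hsqeven : ∀ n, coeff (2 * (n + 1)) (f ^ 2) = coeff (n + 1) (f ^ 4) + coeff n (o ^ 2) := by
    intro n
    rw [hsq, map_add, coeff_expand_mul, show 2 * (n + 1) = 2 * n + 1 + 1 by ring, coeff_succ_X_mul,
      coeff_expand_two_odd, add_zero, map_add, coeff_succ_X_mul]
  have h4odd : ∀ n, coeff (2 * n + 1) (f ^ 4) =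
      4 * coeff n ((f ^ 4 + X * o ^ 2) * (f ^ 2 * o)) := by
    intro n
    have h1 : f ^ 4 = expand 2 two_ne_zero ((f ^ 4 + X * o ^ 2) ^ 2 + X * (C 2 * (f ^ 2 * o)) ^ 2) +
        X * expand 2 two_ne_zero (C 4 * ((f ^ 4 + X * o ^ 2) * (f ^ 2 * o))) := by
      calc f ^ 4 = (f ^ 2) ^ 2 := by ring
        _ = _ := by
          conv_lhs => rw [hsq]
          simp only [map_add, map_mul, map_pow, expand_X, expand_C]
          rw [show (C 2 : ℤ⟦X⟧) = 2 from rfl, show (C 4 : ℤ⟦X⟧) = 4 from rfl]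
          ring
    rw [h1, map_add, coeff_expand_two_odd, coeff_X_mul_expand_two, coeff_C_mul, ← h1, zero_add]
  obtain ⟨g, hg⟩ := exists_pow_eq_expand_add 2 f
  have v1 : VanishesMod 2 3 1 (f ^ 2) := by
    rw [hg]
    refine VanishesMod.add (fun n ↦ ?_) (vanishesMod_C_mul _ _ _ _)
    by_cases hn : 2 ∣ 3 * n + 1
    · obtain ⟨k, hk⟩ := hn
      obtain ⟨j, rfl⟩ : ∃ j, k = 3 * j + 2 := ⟨k / 3, by lia⟩
      rw [hk, coeff_expand_mul]
      exact hf j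
    · rw [coeff_expand_of_not_dvd _ _ _ hn]
      exact dvd_zero _
  have v1o : VanishesMod 2 3 1 (f ^ 2 * o) := by
    have h1 : f ^ 2 * o = f ^ 2 * expand 3 three_ne_zero (expand 2 two_ne_zero v) +
        C 2 * (2 * f ^ 2 * w) := by
      rw [expand_expand]
      simp only [Nat.reduceMul]
      rw [hv, show (C 2 : ℤ⟦X⟧) = 2 from rfl, show (C 4 : ℤ⟦X⟧) = 4 from rfl]
      ring
    rw [h1]
    exact (v1.mul_expand (by norm_num) _ _).add (vanishesMod_C_mul _ _ _ _)
  have v2 : VanishesMod 4 6 3 (f ^ 2) := by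
    intro n
    rw [show 6 * n + 3 = 2 * (3 * n + 1) + 1 by ring, hsqodd]
    exact mul_dvd_mul_left 2 (v1o n)
  have v2o : VanishesMod 4 6 3 (f ^ 2 * o) := by
    have h1 : f ^ 2 * o = f ^ 2 * expand 6 (by norm_num) v + C 4 * (f ^ 2 * w) := by
      rw [hv]
      ring
    rw [h1]
    exact (v2.mul_expand (by norm_num) _ _).add (vanishesMod_C_mul _ _ _ _)
  refine ⟨fun n ↦ ?_, fun n ↦ ?_, fun n ↦ ?_⟩
  · rw [show 12 * n + 11 = 2 * (6 * n + 5) + 1 by ring, hodd]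
    exact ho n
  · rw [show 24 * n + 14 = 2 * (2 * (6 * n + 3) + 1) by ring, heven, hsqodd]
    exact mul_dvd_mul_left 2 (v2o n)
  · rw [show 48 * n + 44 = 2 * (2 * ((12 * n + 10) + 1)) by ring, heven, hsqeven]
    refine dvd_add ?_ ?_
    · rw [show 12 * n + 10 + 1 = 2 * (6 * n + 5) + 1 by ring, h4odd]
      refine mul_dvd_mul_left (b := (2 : ℤ)) 4 ?_
      -- Modulo 2, f^6 is the square of f^3, hence a series in q^2, which misses 6n+5.
      obtain ⟨g', hg'⟩ := exists_pow_eq_expand_add 2 (f ^ 3)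
      have hA : VanishesMod 2 6 5 (f ^ 6) := by
        rw [show f ^ 6 = (f ^ 3) ^ 2 by ring, hg']
        exact (vanishesMod_expand _ (by lia) _).add (vanishesMod_C_mul _ _ _ _)
      have hB : VanishesMod 2 6 4 (f ^ 2) := fun n ↦ by
        rw [show 6 * n + 4 = 3 * (2 * n + 1) + 1 by ring]
        exact v1 _
      have h1 : (f ^ 4 + X * o ^ 2) * (f ^ 2 * o) = f ^ 6 * expand 6 (by norm_num) v +
          X * (f ^ 2 * expand 6 (by norm_num) (v ^ 3)) + C 2 * (2 * f ^ 6 * w + X * f ^ 2 *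
          (6 * expand 6 (by norm_num) v ^ 2 * w + 24 * expand 6 (by norm_num) v * w ^ 2 +
            32 * w ^ 3)) := by
        rw [hv, map_pow, show (C 2 : ℤ⟦X⟧) = 2 from rfl, show (C 4 : ℤ⟦X⟧) = 4 from rfl]
        ring
      rw [h1]
      exact ((hA.mul_expand (by norm_num) _ _).add
        (VanishesMod.X_mul (hB.mul_expand (by norm_num) _ _))).add (vanishesMod_C_mul _ _ _ _) n
    -- Squaring v(q^6) + 4w improves the congruence from modulo 4 to modulo 8.
    · have h1 : o ^ 2 = expand 6 (by norm_num) (v ^ 2) +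
          C 8 * (expand 6 (by norm_num) v * w + 2 * w ^ 2) := by
        rw [hv, map_pow, show (C 8 : ℤ⟦X⟧) = 8 from rfl, show (C 4 : ℤ⟦X⟧) = 4 from rfl]
        ring
      rw [h1]
      exact ((vanishesMod_expand (m := 12) (r := 10) _ (by lia) _).add
        (vanishesMod_C_mul _ _ _ _)) n

theorem theorem6p1 :
    (∀ n : ℕ, RD 4 9 (24 * n + 23) ≡ 0 [MOD 24]) ∧
    (∀ n : ℕ, RD 4 9 (48 * n + 29) ≡ 0 [MOD 24]) ∧
    (∀ n : ℕ, RD 4 9 (96 * n + 89) ≡ 0 [MOD 24]) := by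
  obtain ⟨f, hf⟩ := exists_quotient
  obtain ⟨o, ho⟩ := exists_odd_part
  obtain ⟨ho8, ho4⟩ := odd_part_properties ho
  obtain ⟨h₁, h₂, h₃⟩ := vanishesMod_of_dissect (quotient_dissect hf ho) (quotient_vanishesMod_two hf)
    ho8 ho4
  have hgen := genFun_regularDistinct (l := 4) (t := 9) (by norm_num) (by norm_num)
  have hodd : ∀ n, (RD 4 9 (2 * n + 1) : ℤ) = coeff n f := fun n ↦ by
    rw [← coeff_genFun_odd hgen hf, coeff_mk]
  -- The constant coefficient of f is excluded, being 1 modulo 3; none of the three progressions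
  -- contains it.
  have hthree : ∀ n, n ≠ 0 → 3 ∣ coeff n f := fun n hn ↦ by
    have h := C_dvd_iff.mp (quotient_sub_one_dvd_three hf) n
    rwa [map_sub, coeff_one, if_neg hn, sub_zero] at h
  have main : ∀ n, n ≠ 0 → 8 ∣ coeff n f → RD 4 9 (2 * n + 1) ≡ 0 [MOD 24] := fun n hn h8 ↦ by
    have h3 := hthree n hn
    rw [← hodd] at h3 h8
    rw [Nat.modEq_zero_iff_dvd]
    lia
  refine ⟨fun n ↦ ?_, fun n ↦ ?_, fun n ↦ ?_⟩
  · rw [show 24 * n + 23 = 2 * (12 * n + 11) + 1 by ring]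
    exact main _ (by lia) (h₁ n)
  · rw [show 48 * n + 29 = 2 * (24 * n + 14) + 1 by ring]
    exact main _ (by lia) (h₂ n)
  · rw [show 96 * n + 89 = 2 * (48 * n + 44) + 1 by ring]
    exact main _ (by lia) (h₃ n)
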